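/- Let $\Sigma$ and $\Gamma$ be finite alphabets and let $\#$ be a padding symbol in neither. Let $f\colon\Sigma^*\to\Gamma^*$ be a transduction computed by an S-RASP program with minimum vector length $q$. Then $f$ is computed, with the same minimum vector length $q$, by a masked average-hard attention transformer encoder whose position encoding consists only of $i/n$ and $1/(i+2)^2$. *Computing a transduction.* A device mapping vectors in $(\Sigma\cup\{\#\})^n$ to vectors of length $n$ computes $f$ with minimum vector length $q$ if $q\colon\mathbb N\to\mathbb N$ is nondecreasing and, for all $w\in\Sigma^*$, $q(|w|)\ge|f(w)|$ and for all $n>\max(|w|,q(|w|))$ its output on $w\#^{n-|w|}$ is $f(w)\#^{n-|f(w)|}$. *S-RASP.* A program is a finite sequence of definitions of vectors of length $n$, of type bool, char (values in a finite alphabet $\Delta\supseteq\Sigma\cup\Gamma\cup\{\#\}$) or nat (values in $\{0,\dots,n-1\}$), starting from the input vector $\mathrm{in}$ and $\mathrm{pos}(i)=i$; a char vector is designated as the output. Integer results are clipped to $\{0,\dots,n-1\}$. Expressions are built from entries $P(x)$ of previously defined vectors, where $x$ is a position variable, with $\top,\bot,\land,\lor,\lnot$, symbols, equality of symbols, $0,1,+,-$,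 integer comparisons containing at most one position variable, and conditionals. A definition $P(i)=\cdots$ is one of: an expression in $i$; a prefix sum $\sum_{j\le i}V(j)$ of an integer expression $V(j)$; or a leftmost or rightmost attention operation, whose value is $V(j)$ for the least (resp. greatest) $j$ with $M(i,j)\wedge S(i,j)$, and $D(i)$ if there is no such $j$. Here $M(i,j)$ is one of $\top,\ j<i,\ j\le i,\ j>i,\ j\ge i$; $S(i,j)$ is a Boolean expression in $i,j$ or a test $V_1(i)=V_2(j)$ between previously defined integer vectors; and $V(j)$, $D(i)$ are expressions of the type of $P$ in the one variable indicated. *Transformers.* An encoder has a dimension $d$ and a finite list of layers, both independent of $n$ and of the input. It acts on sequences $u_{-1},u_0,\dots,u_{n-1}\in\mathbb R^d$. A position-wise layer is $u_i'=u_i+F(u_i)$ with $F$ a two-layer ReLU feed-forward network (with biases). An average-hard attention layer, given by linear maps $Q,K,V\colon\mathbb R^d\to\mathbb R^d$, is $u_i'=u_i+\frac1{|M_i|}\sum_{j\in M_i}Vu_j$, where $M_i$ is the set of allowed positions $j$ maximizing $\langle Qu_i,Ku_j\rangle$; all positions are allowed, or only $j<i$, or only $j\le i$; if no position is allowed, $u_i'=u_i$.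 Fix any orderings of $\Sigma\cup\{\#\}$ and $\Gamma\cup\{\#\}$, and let $k=|\Sigma|+1$, $k'=|\Gamma|+1$, where $d\ge k+2$ and $d\ge k'$. Initially, the first $k$ coordinates of $u_i$ hold the one-hot encoding of the $i$-th symbol of the padded input (zero for $i=-1$), the next two hold $i/n$ and $1/(i+2)^2$, and the rest are $0$. The output is the vector whose one-hot encoding is held by the first $k'$ coordinates of the final $u_0,\dots,u_{n-1}$; these coordinates of the final $u_{-1}$ must be $0$. -/

import Mathlib

/-! ## Transductions on padded vectors

The padding symbol is `none`, so `Option A` is the alphabet `A` together with the padding symbol. -/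

/-- The vector `w · pad^(n - |w|)` of length `n` (used when `w.length < n`). -/
def padTo {A : Type*} (n : ℕ) (w : List A) : Fin n → Option A := fun i => w[i.val]?

/-- `R n a b` says that a device, run on the vector `a` of length `n`, outputs the vector `b`.
`ComputesWith R f q` says that the device computes the transduction `f` with minimum vector
length `q`: for every input `w` and every `n` exceeding both `|w|` and `q |w|`, running on `w`
padded to length `n` yields `f w` padded to length `n`. -/
def ComputesWith {A B : Type*} (R : ∀ n : ℕ, (Fin n → Option A) → (Fin n → Option B) → Prop)
    (f : List A → List B) (q : ℕ → ℕ) : Prop :=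
  Monotone q ∧ ∀ w : List A, (f w).length ≤ q w.length ∧
    ∀ n : ℕ, w.length < n → q w.length < n → R n (padTo n w) (padTo n (f w))

/-! ## S-RASP -/

namespace SRASP

/-- The three types of values. -/
inductive Ty
  | bool
  | char
  | nat

/-- Values; `Δ` is the symbol alphabet. Every operation below keeps integers in `[0, n - 1]`. -/
abbrev Ty.Val (Δ : Type) : Ty → Type
  | .bool => Bool
  | .char => Δ
  | .nat => ℕ

/-- `Name Θ τ`: a name of a vector of type `τ` among the vectors defined so far, whose types
are listed in `Θ` (latest first). -/
inductive Name : List Ty → Ty → Type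
  | here {Θ : List Ty} {τ : Ty} : Name (τ :: Θ) τ
  | there {Θ : List Ty} {σ τ : Ty} : Name Θ τ → Name (σ :: Θ) τ

/-- The contents of all the vectors defined so far, each of length `n`. -/
def Env (Δ : Type) (n : ℕ) (Θ : List Ty) : Type :=
  ∀ τ : Ty, Name Θ τ → Fin n → τ.Val Δ

def Env.nil {Δ : Type} {n : ℕ} : Env Δ n [] := fun _ x => nomatch x

def Env.cons {Δ : Type} {n : ℕ} {Θ : List Ty} {σ : Ty} (v : Fin n → σ.Val Δ)
    (ρ : Env Δ n Θ) : Env Δ n (σ :: Θ)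
  | _, .here => v
  | _, .there x => ρ _ x

/-- Integer comparisons. -/
inductive Cmp
  | eq | ne | lt | le | gt | ge

def Cmp.test : Cmp → ℕ → ℕ → Bool
  | .eq, a, b => decide (a = b)
  | .ne, a, b => decide (a ≠ b)
  | .lt, a, b => decide (a < b)
  | .le, a, b => decide (a ≤ b)
  | .gt, a, b => decide (a > b)
  | .ge, a, b => decide (a ≥ b)

/-- `Expr Δ Θ m τ`: expressions of type `τ` over the vectors `Θ`, with free variables among
`m` position variables. Only `m = 1` (the variable `i`, or `j`) and `m = 2` (variable `0` is
`i`, variable `1` is `j`) are used. Integer comparisons have at most one free variable, hence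
the variable `x` and the one-variable operands in `cmp`. -/
inductive Expr (Δ : Type) (Θ : List Ty) : ℕ → Ty → Type
  | vec {m : ℕ} {τ : Ty} (P : Name Θ τ) (x : Fin m) : Expr Δ Θ m τ
  | ite {m : ℕ} {τ : Ty} (a : Expr Δ Θ m τ) (c : Expr Δ Θ m .bool) (b : Expr Δ Θ m τ) :
      Expr Δ Θ m τ
  | top {m : ℕ} : Expr Δ Θ m .bool
  | bot {m : ℕ} : Expr Δ Θ m .bool
  | and {m : ℕ} (a b : Expr Δ Θ m .bool) : Expr Δ Θ m .bool
  | or {m : ℕ} (a b : Expr Δ Θ m .bool) : Expr Δ Θ m .bool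
  | not {m : ℕ} (a : Expr Δ Θ m .bool) : Expr Δ Θ m .bool
  | charEq {m : ℕ} (a b : Expr Δ Θ m .char) : Expr Δ Θ m .bool
  | cmp {m : ℕ} (x : Fin m) (op : Cmp) (a b : Expr Δ Θ 1 .nat) : Expr Δ Θ m .bool
  | sym {m : ℕ} (δ : Δ) : Expr Δ Θ m .char
  | zero {m : ℕ} : Expr Δ Θ m .nat
  | one {m : ℕ} : Expr Δ Θ m .nat
  | add {m : ℕ} (a b : Expr Δ Θ m .nat) : Expr Δ Θ m .nat
  | sub {m : ℕ} (a b : Expr Δ Θ m .nat) : Expr Δ Θ m .nat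

/-- Replace values greater than `n - 1` by `n - 1`. -/
def clip (n x : ℕ) : ℕ := min x (n - 1)

/-- Value of an expression when the position variables are assigned by `p`. Integer results are
clipped to `[0, n - 1]`; subtraction on `ℕ` already replaces negative results by `0`. -/
def Expr.eval {Δ : Type} [DecidableEq Δ] {n : ℕ} {Θ : List Ty} (ρ : Env Δ n Θ) :
    {m : ℕ} → {τ : Ty} → Expr Δ Θ m τ → (Fin m → Fin n) → τ.Val Δ
  | _, _, .vec P x, p => ρ _ P (p x)
  | _, _, .ite a c b, p => bif c.eval ρ p then a.eval ρ p else b.eval ρ p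
  | _, _, .top, _ => true
  | _, _, .bot, _ => false
  | _, _, .and a b, p => Bool.and (a.eval ρ p) (b.eval ρ p)
  | _, _, .or a b, p => Bool.or (a.eval ρ p) (b.eval ρ p)
  | _, _, .not a, p => Bool.not (a.eval ρ p)
  | _, _, .charEq a b, p => decide (@Eq Δ (a.eval ρ p) (b.eval ρ p))
  | _, _, .cmp x op a b, p => op.test (a.eval ρ (fun _ => p x)) (b.eval ρ (fun _ => p x))
  | _, _, .sym δ, _ => δ
  | _, _, .zero, _ => Nat.zero
  | _, _, .one, _ => clip n 1
  | _, _, .add a b, p => clip n (Nat.add (a.eval ρ p) (b.eval ρ p))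
  | _, _, .sub a b, p => Nat.sub (a.eval ρ p) (b.eval ρ p)

/-- Mask predicates: no masking, future masking (strict or not), past masking (strict or not). -/
inductive Mask
  | none | lt | le | gt | ge

/-- The mask predicate `M(i, j)`. -/
def Mask.test {n : ℕ} : Mask → Fin n → Fin n → Bool
  | .none, _, _ => true
  | .lt, i, j => decide (j < i)
  | .le, i, j => decide (j ≤ i)
  | .gt, i, j => decide (j > i)
  | .ge, i, j => decide (j ≥ i)

inductive Choice
  | leftmost | rightmost

/-- Attention predicates `S(i, j)`: a Boolean expression in `i` and `j`, or an equality test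
`V₁(i) = V₂(j)` between two previously defined integer vectors. -/
inductive AttnPred (Δ : Type) (Θ : List Ty)
  | expr (e : Expr Δ Θ 2 .bool)
  | natEq (V₁ V₂ : Name Θ .nat)

def AttnPred.test {Δ : Type} [DecidableEq Δ] {n : ℕ} {Θ : List Ty} (ρ : Env Δ n Θ)
    (S : AttnPred Δ Θ) (i j : Fin n) : Bool :=
  match S with
  | .expr e => e.eval ρ ![i, j]
  | .natEq V₁ V₂ => decide (@Eq ℕ (ρ _ V₁ i) (ρ _ V₂ j))

/-- Right-hand sides of definitions: position-wise operations, leftmost or rightmost attention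
operations with value `V(j)` and default `D(i)`, and prefix sums of `V(j)` over `j ≤ i`. -/
inductive Op (Δ : Type) (Θ : List Ty) : Ty → Type
  | pointwise {τ : Ty} (e : Expr Δ Θ 1 τ) : Op Δ Θ τ
  | attn {τ : Ty} (c : Choice) (M : Mask) (S : AttnPred Δ Θ) (V D : Expr Δ Θ 1 τ) : Op Δ Θ τ
  | prefixSum (V : Expr Δ Θ 1 .nat) : Op Δ Θ .nat

/-- The vector defined by an operation. -/
def Op.eval {Δ : Type} [DecidableEq Δ] {n : ℕ} {Θ : List Ty} (ρ : Env Δ n Θ) :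
    {τ : Ty} → Op Δ Θ τ → Fin n → τ.Val Δ
  | _, .pointwise e, i => e.eval ρ (fun _ => i)
  | _, .attn c M S V D, i =>
      let s : Finset (Fin n) :=
        Finset.univ.filter (fun j => M.test i j = true ∧ S.test ρ i j = true)
      if h : s.Nonempty then
        match c with
        | .leftmost => V.eval ρ (fun _ => s.min' h)
        | .rightmost => V.eval ρ (fun _ => s.max' h)
      else D.eval ρ (fun _ => i)
  | _, .prefixSum V, i =>
      clip n (Finset.sum (M := ℕ) (Finset.univ.filter (fun j : Fin n => j ≤ i))
        (fun j => V.eval ρ (fun _ => j)))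

/-- A sequence of vector definitions, each using only vectors defined before it, ending with
the designation of a symbol vector as the output. -/
inductive Code (Δ : Type) : List Ty → Type
  | out {Θ : List Ty} (P : Name Θ .char) : Code Δ Θ
  | define {Θ : List Ty} {τ : Ty} (op : Op Δ Θ τ) (rest : Code Δ (τ :: Θ)) : Code Δ Θ

def Code.eval {Δ : Type} [DecidableEq Δ] {n : ℕ} :
    {Θ : List Ty} → Code Δ Θ → Env Δ n Θ → Fin n → Δ
  | _, .out P, ρ => ρ .char P
  | _, .define op rest, ρ => rest.eval (ρ.cons (op.eval ρ))

/-- The initial vectors: `in` (the input symbols) and `pos` (with `pos(i) = i`). -/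
def initEnv {Δ : Type} {n : ℕ} (a : Fin n → Δ) : Env Δ n [.char, .nat] :=
  Env.cons (σ := .char) a (Env.cons (σ := .nat) (fun i => i.val) Env.nil)

/-- An S-RASP program with input alphabet `A` and output alphabet `B`. Its finite symbol
alphabet `Δ` contains the input symbols, the output symbols and the padding symbol. -/
structure Program (A B : Type*) where
  Δ : Type
  [fintypeΔ : Fintype Δ]
  [decEqΔ : DecidableEq Δ]
  inSym : Option A ↪ Δ
  outSym : Option B ↪ Δ
  pad_eq : inSym none = outSym none
  code : Code Δ [.char, .nat]

/-- On the padded input vector `a`, the program outputs the padded vector `b`. -/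
def Program.Outputs {A B : Type*} (P : Program A B) (n : ℕ)
    (a : Fin n → Option A) (b : Fin n → Option B) : Prop :=
  letI := P.decEqΔ
  P.code.eval (initEnv (fun i => P.inSym (a i))) = fun i => P.outSym (b i)

end SRASP

/-! ## Masked average-hard attention transformer encoders

An activation sequence with `n` string positions has the `n + 1` positions `-1, 0, …, n - 1`.
They are indexed by `p : Fin (n + 1)`: index `0` is the default position `-1`, and index `i + 1`
is the string position `i`. -/

noncomputable section

namespace AHAT

/-- Activation sequences of vectors in `ℝ^d`. -/
abbrev Act (d n : ℕ) : Type := Fin (n + 1) → Fin d → ℝ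

/-- A two-layer feed-forward network with ReLU activations. -/
structure FFN (d : ℕ) where
  hidden : ℕ
  W₁ : Matrix (Fin hidden) (Fin d) ℝ
  b₁ : Fin hidden → ℝ
  W₂ : Matrix (Fin d) (Fin hidden) ℝ
  b₂ : Fin d → ℝ

def FFN.apply {d : ℕ} (F : FFN d) (x : Fin d → ℝ) : Fin d → ℝ :=
  F.W₂.mulVec (fun k => max 0 ((F.W₁.mulVec x + F.b₁) k)) + F.b₂

/-- No masking, strict future masking (only `j < i`), non-strict future masking (only `j ≤ i`). -/
inductive Mask
  | none | strictFuture | future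

/-- The positions that position `p` may attend to. -/
def Mask.allowed {n : ℕ} : Mask → Fin (n + 1) → Finset (Fin (n + 1))
  | .none, _ => Finset.univ
  | .strictFuture, p => Finset.univ.filter (fun r => r < p)
  | .future, p => Finset.univ.filter (fun r => r ≤ p)

/-- An average-hard attention layer: query, key and value maps and a mask. -/
structure Attn (d : ℕ) where
  mask : Mask
  Q : (Fin d → ℝ) →ₗ[ℝ] (Fin d → ℝ)
  K : (Fin d → ℝ) →ₗ[ℝ] (Fin d → ℝ)
  V : (Fin d → ℝ) →ₗ[ℝ] (Fin d → ℝ)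

/-- The attention score. -/
def Attn.score {d n : ℕ} (L : Attn d) (u : Act d n) (p r : Fin (n + 1)) : ℝ :=
  dotProduct (L.Q (u p)) (L.K (u r))

/-- The allowed positions of maximal score. -/
def Attn.maximizers {d n : ℕ} (L : Attn d) (u : Act d n) (p : Fin (n + 1)) :
    Finset (Fin (n + 1)) :=
  open Classical in
  (L.mask.allowed p).filter (fun r => ∀ r' ∈ L.mask.allowed p, L.score u p r' ≤ L.score u p r)

inductive Layer (d : ℕ)
  | positionwise (F : FFN d)
  | attention (L : Attn d)

/-- The action of a layer, with residual connection. In an attention layer the values at the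
maximizers are averaged; when there is no allowed position (strict masking at the default
position) the vector is unchanged, the sum being empty. -/
def Layer.apply {d n : ℕ} : Layer d → Act d n → Act d n
  | .positionwise F, u => fun p => u p + F.apply (u p)
  | .attention L, u => fun p =>
      u p + ((L.maximizers u p).card : ℝ)⁻¹ • ∑ r ∈ L.maximizers u p, L.V (u r)

/-- A transformer encoder for `k` input symbols and `k'` output symbols (padding included).
Its dimension and its layers do not depend on the length of the input. -/
structure Encoder (k k' : ℕ) where
  d : ℕ
  input_le : k + 2 ≤ d
  output_le : k' ≤ d
  layers : List (Layer d)

/-- The initial activation sequence: coordinates `0, …, k - 1` hold the one-hot encoding of the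
symbol (zero at the default position), coordinate `k` holds `i / n`, coordinate `k + 1` holds
`1 / (i + 2)^2`, where `i = p - 1` is the position, and all others hold `0`. -/
def Encoder.initial {A : Type*} {k k' : ℕ} (T : Encoder k k') (σ : Option A ≃ Fin k) {n : ℕ}
    (a : Fin n → Option A) : Act T.d n := fun p c =>
  let i : ℝ := (p.val : ℝ) - 1
  if c.val < k then
    Fin.cases (0 : ℝ) (fun t : Fin n => if (σ (a t)).val = c.val then 1 else 0) p
  else if c.val = k then i / n
  else if c.val = k + 1 then 1 / (i + 2) ^ 2
  else 0

/-- The final activation sequence. -/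
def Encoder.final {A : Type*} {k k' : ℕ} (T : Encoder k k') (σ : Option A ≃ Fin k) {n : ℕ}
    (a : Fin n → Option A) : Act T.d n :=
  T.layers.foldl (fun u L => L.apply u) (T.initial σ a)

/-- On the padded input vector `a`, the encoder outputs the padded vector `b`: the first `k'`
coordinates of the final activations hold the one-hot encoding of `b` (zero at the default
position). `σ` and `γ` are the orderings of the two alphabets. -/
def Encoder.Outputs {A B : Type*} {k k' : ℕ} (T : Encoder k k') (σ : Option A ≃ Fin k)
    (γ : Option B ≃ Fin k') (n : ℕ) (a : Fin n → Option A) (b : Fin n → Option B) : Prop :=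
  (∀ (i : Fin n) (c : Fin k'),
    T.final σ a i.succ (Fin.castLE T.output_le c) = if γ (b i) = c then 1 else 0) ∧
  ∀ c : Fin k', T.final σ a 0 (Fin.castLE T.output_le c) = 0

end AHAT

end

namespace AHAT

/-! ## Features computed by encoders -/

/-! Every vector of the program is encoded by real functions on positions: truth values and one-hot
symbols by 0 and 1, an integer x by x/n (`Rep`). The class of functions obtainable from the initial
coordinates by linear combinations, ReLU and attention (`Computable`) is shown to be closed under
all S-RASP operations. The simulation is exact for every n and every input vector, so q does not
change.

Each generating step can be realized by one new layer writing to one new coordinate, which leaves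
everything computed before intact. A last linear layer copies the desired functions to the first
coordinates (`Computable.exists_encoder`).

The main difficulty is that activations cannot be multiplied at a position; products occur only in
scores, between a function of i and a function of j. Three devices make up for this. First, the
default position acts as a threshold: giving it score θ(i) decides whether some string position
scores above θ(i) (`Comp.select`); comparisons and defaults rest on this. Second, with y = 1/(j+2),
the score 2y - (x+2)y² is a parabola with peak at y = 1/(x+2), so it selects position x, or the last
one if x ≥ n. It still does so when multiplied by an unknown positive factor, which turns prefix
averages into clipped prefix sums (`Comp.lookup_min`, `Comp.prefixSum`). Third, a predicate of i and
j is expressed by a score that is 0 where it holds and at most -δ(i) elsewhere (`Attendable`); a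
perturbation smaller than δ then picks the leftmost or rightmost position.

Boolean predicates are combinations of products of Boolean functions of i and of j, because integer
comparisons involve only one variable. Equality of integers uses the square of 1/(x+2) - 1/(y+2). -/

/-- A real-valued function of the input vector and of a position of its activation sequence. -/
abbrev Feature (A : Type*) : Type _ := ∀ n : ℕ, (Fin n → Option A) → Fin (n + 1) → ℝ

/-- The average of `v` over the allowed positions of maximal score. -/
noncomputable def attend {n : ℕ} (M : Mask) (s : Fin (n + 1) → Fin (n + 1) → ℝ)
    (v : Fin (n + 1) → ℝ) (p : Fin (n + 1)) : ℝ :=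
  open Classical in
  (((M.allowed p).filter (fun r => ∀ r' ∈ M.allowed p, s p r' ≤ s p r)).card : ℝ)⁻¹ *
    ∑ r ∈ (M.allowed p).filter (fun r => ∀ r' ∈ M.allowed p, s p r' ≤ s p r), v r

/-- The features generated from the initial activations by linear combinations, ReLU and
average-hard attention. -/
inductive Computable {A : Type*} {k : ℕ} (σ : Option A ≃ Fin k) : Feature A → Prop
  | input (c : Fin k) : Computable σ fun _ a p =>
      Fin.cases (0 : ℝ) (fun t => if σ (a t) = c then 1 else 0) p
  | pos : Computable σ fun n _ p => ((p.val : ℝ) - 1) / n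
  | invSq : Computable σ fun _ _ p => 1 / (((p.val : ℝ) - 1) + 2) ^ 2
  | one : Computable σ fun _ _ _ => 1
  | add {f g : Feature A} : Computable σ f → Computable σ g →
      Computable σ fun n a p => f n a p + g n a p
  | smul (c : ℝ) {f : Feature A} : Computable σ f → Computable σ fun n a p => c * f n a p
  | relu {f : Feature A} : Computable σ f → Computable σ fun n a p => max 0 (f n a p)
  | attend (M : Mask) {ι : Type} [Fintype ι] {q κ : ι → Feature A} {v : Feature A} :
      (∀ t, Computable σ (q t)) → (∀ t, Computable σ (κ t)) → Computable σ v →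
      Computable σ fun n a p => AHAT.attend M (fun p r => ∑ t, q t n a p * κ t n a r) (v n a) p

/-! ### Adding one coordinate to an encoder -/

/-- Append a zero coordinate. -/
def padLast (d : ℕ) : (Fin d → ℝ) →ₗ[ℝ] (Fin (d + 1) → ℝ) where
  toFun x := Fin.snoc (α := fun _ => ℝ) x 0
  map_add' x y := by
    funext c
    refine Fin.lastCases ?_ (fun c => ?_) c <;> simp
  map_smul' r x := by
    funext c
    refine Fin.lastCases ?_ (fun c => ?_) c <;> simp

/-- Forget the last coordinate. -/
def dropLast (d : ℕ) : (Fin (d + 1) → ℝ) →ₗ[ℝ] (Fin d → ℝ) :=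
  LinearMap.funLeft ℝ ℝ Fin.castSucc

@[simp] lemma padLast_castSucc {d : ℕ} (x : Fin d → ℝ) (c : Fin d) :
    padLast d x c.castSucc = x c := by simp [padLast]

@[simp] lemma padLast_last {d : ℕ} (x : Fin d → ℝ) : padLast d x (Fin.last d) = 0 := by
  simp [padLast]

@[simp] lemma dropLast_apply {d : ℕ} (x : Fin (d + 1) → ℝ) (c : Fin d) :
    dropLast d x c = x c.castSucc := rfl

@[simp] lemma dropLast_padLast {d : ℕ} (x : Fin d → ℝ) : dropLast d (padLast d x) = x := by
  funext c; simp

lemma dotProduct_padLast {d : ℕ} (x y : Fin d → ℝ) :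
    dotProduct (padLast d x) (padLast d y) = dotProduct x y := by
  simp [dotProduct, Fin.sum_univ_castSucc]

/-- A layer acting on all coordinates but the last. -/
def Layer.lift {d : ℕ} : Layer d → Layer (d + 1)
  | .positionwise F => .positionwise
      { hidden := F.hidden
        W₁ := Matrix.of fun h => padLast d (F.W₁ h)
        b₁ := F.b₁
        W₂ := Matrix.of fun c h => padLast d (fun c => F.W₂ c h) c
        b₂ := padLast d F.b₂ }
  | .attention L => .attention
      { mask := L.mask
        Q := padLast d ∘ₗ L.Q ∘ₗ dropLast d
        K := padLast d ∘ₗ L.K ∘ₗ dropLast d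
        V := padLast d ∘ₗ L.V ∘ₗ dropLast d }

lemma Layer.lift_apply {d n : ℕ} (L : Layer d) (u : Act d n) :
    L.lift.apply (fun p => padLast d (u p)) = fun p => padLast d (L.apply u p) := by
  cases L with
  | positionwise F =>
    funext p
    simp only [Layer.lift, Layer.apply, map_add]
    congr 1
    funext c
    refine Fin.lastCases ?_ (fun c => ?_) c
    · simp [FFN.apply, Matrix.mulVec, dotProduct]
    · simp [FFN.apply, Matrix.mulVec, dotProduct, Fin.sum_univ_castSucc]
  | attention L =>
    funext p
    have h : ∀ p r, Attn.score (d := d + 1)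
        { mask := L.mask
          Q := padLast d ∘ₗ L.Q ∘ₗ dropLast d
          K := padLast d ∘ₗ L.K ∘ₗ dropLast d
          V := padLast d ∘ₗ L.V ∘ₗ dropLast d } (fun p => padLast d (u p)) p r = L.score u p r := by
      intro p r
      simp [Attn.score, dotProduct_padLast]
    simp [Layer.lift, Layer.apply, Attn.maximizers, h]

/-- The encoder with an unused last coordinate. -/
abbrev Encoder.lift {k k' : ℕ} (T : Encoder k k') : Encoder k k' where
  d := T.d + 1
  input_le := T.input_le.trans (Nat.le_succ _)
  output_le := T.output_le.trans (Nat.le_succ _)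
  layers := T.layers.map Layer.lift

lemma Encoder.lift_initial {A : Type*} {k k' : ℕ} (T : Encoder k k') (σ : Option A ≃ Fin k)
    {n : ℕ} (a : Fin n → Option A) :
    T.lift.initial σ a = fun p => padLast T.d (T.initial σ a p) := by
  funext p (c : Fin (T.d + 1))
  have := T.input_le
  refine Fin.lastCases ?_ (fun c => ?_) c
  · simp only [padLast_last, Encoder.initial, Fin.val_last]
    rw [if_neg (by omega), if_neg (by omega), if_neg (by omega)]
  · simp [Encoder.initial]

lemma Encoder.lift_final {A : Type*} {k k' : ℕ} (T : Encoder k k') (σ : Option A ≃ Fin k)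
    {n : ℕ} (a : Fin n → Option A) :
    T.lift.final σ a = fun p => padLast T.d (T.final σ a p) := by
  have h : ∀ (l : List (Layer T.d)) (u : Act T.d n),
      (l.map Layer.lift).foldl (fun u L => L.apply u) (fun p => padLast T.d (u p)) =
        fun p => padLast T.d (l.foldl (fun u L => L.apply u) u p) := by
    intro l
    induction l with
    | nil => intro u; rfl
    | cons L l ih => intro u; rw [List.map_cons, List.foldl_cons, Layer.lift_apply, ih]; rfl
  rw [Encoder.final, Encoder.lift_initial]
  exact h _ _

/-- The encoder with an additional final layer. -/
abbrev Encoder.snoc {k k' : ℕ} (T : Encoder k k') (L : Layer T.d) : Encoder k k' :=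
  { T with layers := T.layers ++ [L] }

lemma Encoder.snoc_final {A : Type*} {k k' : ℕ} (T : Encoder k k') (L : Layer T.d)
    (σ : Option A ≃ Fin k) {n : ℕ} (a : Fin n → Option A) :
    (T.snoc L).final σ a = L.apply (T.final σ a) := by
  simp only [Encoder.final, Encoder.snoc, List.foldl_append, List.foldl_cons, List.foldl_nil]
  rfl

/-! ### Realizing computable features -/

/-- The feature `f` is a linear functional of the final activations of `T`. -/
def Encoder.Spans {A : Type*} {k k' : ℕ} (T : Encoder k k') (σ : Option A ≃ Fin k)
    (f : Feature A) : Prop :=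
  ∃ l : (Fin T.d → ℝ) →ₗ[ℝ] ℝ, ∀ n a p, f n a p = l (T.final σ (n := n) a p)

/-- If a layer on one more coordinate leaves the old coordinates unchanged and writes `f` to
the new one, some encoder spans `f` and all that `T` spans. -/
lemma Encoder.Spans.extend {A : Type*} {k k' : ℕ} {T : Encoder k k'} {σ : Option A ≃ Fin k}
    {f : Feature A} (L : Layer (T.d + 1))
    (h : ∀ n a p, L.apply (fun p => padLast T.d (T.final σ (n := n) a p)) p =
      padLast T.d (T.final σ a p) + Pi.single (Fin.last T.d) (f n a p)) :
    ∃ T' : Encoder k k', T'.Spans σ f ∧ ∀ g, T.Spans σ g → T'.Spans σ g := by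
  have hT : ∀ n a p, (T.lift.snoc L).final σ (n := n) a p =
      padLast T.d (T.final σ a p) + Pi.single (Fin.last T.d) (f n a p) := by
    intro n a p
    rw [← h, Encoder.snoc_final, Encoder.lift_final]
  refine ⟨T.lift.snoc L, ⟨LinearMap.proj (Fin.last T.d), fun n a p => ?_⟩, ?_⟩
  · rw [hT]
    simp
  · rintro g ⟨l, hl⟩
    refine ⟨l ∘ₗ dropLast T.d, fun n a p => ?_⟩
    rw [hT, hl, LinearMap.comp_apply]
    congr 1
    funext c
    simp

lemma linearMap_eq_sum {d : ℕ} (l : (Fin d → ℝ) →ₗ[ℝ] ℝ) (x : Fin d → ℝ) :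
    l x = ∑ c, l (Pi.single c 1) * x c := by
  conv_lhs => rw [LinearMap.pi_apply_eq_sum_univ l x]
  refine Finset.sum_congr rfl fun c _ => ?_
  rw [smul_eq_mul, mul_comm]
  congr 2
  funext c'
  simp [Pi.single_apply, eq_comm]

/-- One hidden unit evaluates the linear functional and writes to the new coordinate. The bias b is
what makes constants available. -/
lemma Encoder.Spans.relu {A : Type*} {k k' : ℕ} {T : Encoder k k'} {σ : Option A ≃ Fin k}
    {f : Feature A} (hf : T.Spans σ f) (b : ℝ) :
    ∃ T' : Encoder k k', T'.Spans σ (fun n a p => max 0 (f n a p + b)) ∧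
      ∀ g, T.Spans σ g → T'.Spans σ g := by
  obtain ⟨l, hl⟩ := hf
  refine Encoder.Spans.extend (.positionwise
    { hidden := 1
      W₁ := Matrix.of fun _ => padLast T.d (fun c => l (Pi.single c 1))
      b₁ := fun _ => b
      W₂ := Matrix.of fun c _ => Pi.single (M := fun _ => ℝ) (Fin.last T.d) 1 c
      b₂ := 0 }) fun n a p => ?_
  simp only [Layer.apply]
  congr 1
  rw [hl, linearMap_eq_sum]
  funext c
  simp [FFN.apply, Matrix.mulVec, dotProduct, Fin.sum_univ_castSucc, Pi.single_apply]

lemma Encoder.Spans.attend {A : Type*} {k k' : ℕ} {T : Encoder k k'} {σ : Option A ≃ Fin k}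
    (M : Mask) {ι : Type} [Fintype ι] {q κ : ι → Feature A} {v : Feature A}
    (hq : ∀ t, T.Spans σ (q t)) (hκ : ∀ t, T.Spans σ (κ t)) (hv : T.Spans σ v) :
    ∃ T' : Encoder k k', T'.Spans σ
      (fun n a p => AHAT.attend M (fun p r => ∑ t, q t n a p * κ t n a r) (v n a) p) ∧
      ∀ g, T.Spans σ g → T'.Spans σ g := by
  choose lq hlq using hq
  choose lκ hlκ using hκ
  obtain ⟨lv, hlv⟩ := hv
  -- The whole bilinear form is put into the query map and the key map is the identity, so the
  -- number of summands need not fit into the dimension.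
  let Q : (Fin T.d → ℝ) →ₗ[ℝ] (Fin T.d → ℝ) :=
    LinearMap.pi fun c => ∑ t, lκ t (Pi.single c 1) • lq t
  let N : Attn (T.d + 1) :=
    { mask := M
      Q := padLast T.d ∘ₗ Q ∘ₗ dropLast T.d
      K := LinearMap.id
      V := LinearMap.single ℝ (fun _ => ℝ) (Fin.last T.d) ∘ₗ lv ∘ₗ dropLast T.d }
  refine Encoder.Spans.extend (.attention N) fun n a p => ?_
  have hs : ∀ p r, N.score (fun p => padLast T.d (T.final σ (n := n) a p)) p r =
      ∑ t, q t n a p * κ t n a r := by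
    intro p r
    simp only [N, Attn.score, LinearMap.comp_apply, LinearMap.id_apply, dropLast_padLast,
      dotProduct_padLast]
    simp only [hlq, hlκ]
    simp only [Q, dotProduct, LinearMap.pi_apply, LinearMap.sum_apply, LinearMap.smul_apply,
      smul_eq_mul, Finset.sum_mul]
    rw [Finset.sum_comm]
    refine Finset.sum_congr rfl fun t _ => ?_
    rw [linearMap_eq_sum (lκ t), Finset.mul_sum]
    exact Finset.sum_congr rfl fun c _ => by ring
  simp only [Layer.apply, Attn.maximizers, hs, AHAT.attend]
  congr 1
  funext c
  refine Fin.lastCases ?_ (fun c => ?_) c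
  · simp [N, hlv]
  · simp [N]

/-- The encoder without layers. -/
def Encoder.base (k k' : ℕ) : Encoder k k' where
  d := k + 2 + k'
  input_le := Nat.le_add_right _ _
  output_le := Nat.le_add_left _ _
  layers := []

/-- Every encoder spanning the initial features can be extended to one also spanning `f`. -/
def Realizable {A : Type*} {k : ℕ} (k' : ℕ) (σ : Option A ≃ Fin k) (f : Feature A) : Prop :=
  ∀ T : Encoder k k', (∀ g, (Encoder.base k k').Spans σ g → T.Spans σ g) →
    ∃ T' : Encoder k k', T'.Spans σ f ∧ ∀ g, T.Spans σ g → T'.Spans σ g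

/-- `Realizable` quantifies over all starting encoders so that features can be accumulated in a
single encoder; an initial coordinate needs no new layer. -/
lemma Realizable.of_base {A : Type*} {k k' : ℕ} {σ : Option A ≃ Fin k} {f : Feature A}
    (c : Fin (k + 2 + k'))
    (h : ∀ n a p, f n a p = (Encoder.base k k').initial σ (n := n) a p c) :
    Realizable k' σ f := fun T hT =>
  ⟨T, hT f ⟨LinearMap.proj c, h⟩, fun _ => id⟩

lemma Realizable.forall {A : Type*} {k k' : ℕ} {σ : Option A ≃ Fin k} {ι : Type} [Fintype ι]
    {f : ι → Feature A} (hf : ∀ t, Realizable k' σ (f t)) (T : Encoder k k')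
    (hT : ∀ g, (Encoder.base k k').Spans σ g → T.Spans σ g) :
    ∃ T' : Encoder k k', (∀ t, T'.Spans σ (f t)) ∧ ∀ g, T.Spans σ g → T'.Spans σ g := by
  classical
  suffices h : ∀ s : Finset ι, ∃ T' : Encoder k k', (∀ t ∈ s, T'.Spans σ (f t)) ∧
      ∀ g, T.Spans σ g → T'.Spans σ g by
    obtain ⟨T', h, h'⟩ := h Finset.univ
    exact ⟨T', fun t => h t (Finset.mem_univ t), h'⟩
  intro s
  induction s using Finset.induction_on with
  | empty => exact ⟨T, by simp, fun _ => id⟩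
  | insert t s _ ih =>
    obtain ⟨T₁, h₁, h₁'⟩ := ih
    obtain ⟨T₂, h₂, h₂'⟩ := hf t T₁ fun g hg => h₁' g (hT g hg)
    refine ⟨T₂, fun t' ht' => ?_, fun g hg => h₂' g (h₁' g hg)⟩
    rcases Finset.mem_insert.1 ht' with rfl | ht'
    · exact h₂
    · exact h₂' _ (h₁ t' ht')

lemma Computable.realizable {A : Type*} {k : ℕ} (k' : ℕ) {σ : Option A ≃ Fin k} {f : Feature A}
    (hf : Computable σ f) : Realizable k' σ f := by
  induction hf with
  | input c =>
    refine .of_base ⟨c, by omega⟩ fun n a p => ?_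
    simp [Encoder.initial, Fin.ext_iff]
  | pos =>
    refine .of_base ⟨k, by omega⟩ fun n a p => ?_
    simp [Encoder.initial]
  | invSq =>
    refine .of_base ⟨k + 1, by omega⟩ fun n a p => ?_
    simp [Encoder.initial]
  | one =>
    intro T hT
    have h0 : T.Spans σ fun _ _ _ => 0 := ⟨0, fun _ _ _ => rfl⟩
    simpa using h0.relu 1
  | @add f g _ _ ihf ihg =>
    intro T hT
    obtain ⟨T₁, h₁, h₁'⟩ := ihf T hT
    obtain ⟨T₂, h₂, h₂'⟩ := ihg T₁ fun g hg => h₁' g (hT g hg)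
    obtain ⟨l, hl⟩ := h₂' _ h₁
    obtain ⟨l', hl'⟩ := h₂
    exact ⟨T₂, ⟨l + l', fun n a p => by simp [hl, hl']⟩, fun g hg => h₂' g (h₁' g hg)⟩
  | smul c _ ih =>
    intro T hT
    obtain ⟨T₁, ⟨l, hl⟩, h₁'⟩ := ih T hT
    exact ⟨T₁, ⟨c • l, fun n a p => by simp [hl]⟩, h₁'⟩
  | relu _ ih =>
    intro T hT
    obtain ⟨T₁, h₁, h₁'⟩ := ih T hT
    obtain ⟨T₂, h₂, h₂'⟩ := h₁.relu 0
    exact ⟨T₂, by simpa using h₂, fun g hg => h₂' g (h₁' g hg)⟩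
  | attend M _ _ _ ihq ihκ ihv =>
    intro T hT
    obtain ⟨T₁, h₁, h₁'⟩ := Realizable.forall ihq T hT
    obtain ⟨T₂, h₂, h₂'⟩ := Realizable.forall ihκ T₁ fun g hg => h₁' g (hT g hg)
    obtain ⟨T₃, h₃, h₃'⟩ := ihv T₂ fun g hg => h₂' g (h₁' g (hT g hg))
    obtain ⟨T₄, h₄, h₄'⟩ := Encoder.Spans.attend M (fun t => h₃' _ (h₂' _ (h₁ t)))
      (fun t => h₃' _ (h₂ t)) h₃
    exact ⟨T₄, h₄, fun g hg => h₄' g (h₃' g (h₂' g (h₁' g hg)))⟩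

/-- A linear map as a feed-forward network. -/
def FFN.linear {d : ℕ} (M : Matrix (Fin d) (Fin d) ℝ) : FFN d where
  hidden := d + d
  W₁ := Matrix.of (Fin.append M (-M))
  b₁ := 0
  -- Recombines each y as max 0 y - max 0 (-y).
  W₂ := Matrix.of fun c => Fin.append (Pi.single c 1) (-Pi.single c 1)
  b₂ := 0

lemma FFN.linear_apply {d : ℕ} (M : Matrix (Fin d) (Fin d) ℝ) (x : Fin d → ℝ) :
    (FFN.linear M).apply x = M.mulVec x := by
  have h : ∀ y : ℝ, max 0 y + -max 0 (-y) = y := fun y => by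
    rcases le_total 0 y with hy | hy
    · rw [max_eq_right hy, max_eq_left (by linarith)]; simp
    · rw [max_eq_left hy, max_eq_right (by linarith)]; simp
  funext c
  rw [← h (M.mulVec x c)]
  change ∑ t : Fin (d + d), Fin.append (Pi.single c (1 : ℝ)) (-Pi.single c 1) t *
    max 0 (∑ e, Fin.append M (-M) t e * x e + 0) + 0 = _
  have h₁ : ∀ t, Fin.append M (-M) (Fin.castAdd d t) = M t := Fin.append_left _ _
  have h₂ : ∀ t, Fin.append M (-M) (Fin.natAdd d t) = -M t := Fin.append_right _ _
  simp only [Fin.sum_univ_add, Fin.append_left, Fin.append_right, h₁, h₂]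
  simp [Matrix.mulVec, dotProduct, Pi.single_apply]

/-- Any family of computable features can be written to the first coordinates of the final
activations of an encoder. -/
theorem Computable.exists_encoder {A : Type*} {k k' : ℕ} {σ : Option A ≃ Fin k}
    {f : Fin k' → Feature A} (hf : ∀ c, Computable σ (f c)) :
    ∃ T : Encoder k k', ∀ n a p c, T.final σ (n := n) a p (Fin.castLE T.output_le c) =
      f c n a p := by
  obtain ⟨T, hT, -⟩ := Realizable.forall (fun c => (hf c).realizable k') _ fun _ => id
  choose l hl using hT
  -- Subtracting the unit vector cancels the old content of coordinate c, which the residual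
  -- connection would add.
  let M : Matrix (Fin T.d) (Fin T.d) ℝ := Matrix.of fun c e =>
    if h : c.val < k' then l ⟨c, h⟩ (Pi.single e 1) - Pi.single (M := fun _ => ℝ) c 1 e else 0
  refine ⟨T.snoc (.positionwise (FFN.linear M)), fun n a p c => ?_⟩
  rw [Encoder.snoc_final, hl, linearMap_eq_sum]
  simp [Layer.apply, FFN.linear_apply, M, Matrix.mulVec, dotProduct, sub_mul,
    Finset.sum_sub_distrib, Pi.single_apply]

/-! ### Closure properties of computable features -/

/-- An average of equal values is that value, so ties among maximizers are harmless when they agree.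
-/
lemma attend_eq {n : ℕ} {M : Mask} {s : Fin (n + 1) → Fin (n + 1) → ℝ} {v : Fin (n + 1) → ℝ}
    {p : Fin (n + 1)} {c : ℝ} (hne : (M.allowed p).Nonempty)
    (h : ∀ r ∈ M.allowed p, (∀ r' ∈ M.allowed p, s p r' ≤ s p r) → v r = c) :
    attend M s v p = c := by
  classical
  obtain ⟨r, hr, hr'⟩ := Finset.exists_max_image (M.allowed p) (s p) hne
  have hcard : (((M.allowed p).filter
      (fun r => ∀ r' ∈ M.allowed p, s p r' ≤ s p r)).card : ℝ) ≠ 0 :=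
    Nat.cast_ne_zero.2 (Finset.card_ne_zero_of_mem (Finset.mem_filter.2 ⟨hr, hr'⟩))
  have hsum : ∑ r ∈ (M.allowed p).filter (fun r => ∀ r' ∈ M.allowed p, s p r' ≤ s p r), v r =
      ∑ r ∈ (M.allowed p).filter (fun r => ∀ r' ∈ M.allowed p, s p r' ≤ s p r), c :=
    Finset.sum_congr rfl fun r hr => by
      rw [Finset.mem_filter] at hr
      exact h r hr.1 hr.2
  unfold attend
  convert inv_mul_cancel_left₀ hcard c
  rw [hsum, Finset.sum_const, nsmul_eq_mul]

lemma attend_zero_score {n : ℕ} (M : Mask) (v : Fin (n + 1) → ℝ) (p : Fin (n + 1)) :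
    attend M (fun _ _ => 0) v p = ((M.allowed p).card : ℝ)⁻¹ * ∑ r ∈ M.allowed p, v r := by
  simp [attend]

@[simp] lemma Mask.mem_allowed_none {n : ℕ} (p r : Fin (n + 1)) : r ∈ Mask.none.allowed p := by
  simp [Mask.allowed]

@[simp] lemma Mask.mem_allowed_strictFuture {n : ℕ} (p r : Fin (n + 1)) :
    r ∈ Mask.strictFuture.allowed p ↔ r < p := by
  simp [Mask.allowed]

@[simp] lemma Mask.mem_allowed_future {n : ℕ} (p r : Fin (n + 1)) :
    r ∈ Mask.future.allowed p ↔ r ≤ p := by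
  simp [Mask.allowed]

lemma Mask.zero_mem_allowed {n : ℕ} (M : Mask) (i : Fin n) : 0 ∈ M.allowed i.succ := by
  cases M <;> simp

namespace Computable

variable {A : Type*} {k : ℕ} {σ : Option A ≃ Fin k} {f g : Feature A}

lemma congr (hf : Computable σ f) (h : ∀ n a p, g n a p = f n a p) : Computable σ g := by
  have : g = f := by
    funext n a p
    exact h n a p
  exact this ▸ hf

lemma const (c : ℝ) : Computable σ fun _ _ _ => c := by simpa using Computable.one.smul c

lemma sub (hf : Computable σ f) (hg : Computable σ g) :
    Computable σ fun n a p => f n a p - g n a p :=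
  (hf.add (hg.smul (-1))).congr fun _ _ _ => by ring

lemma attend_uniform (M : Mask) (hf : Computable σ f) : Computable σ fun n a p =>
    ((M.allowed p).card : ℝ)⁻¹ * ∑ r ∈ M.allowed p, f n a r := by
  -- With no summands the score is constantly 0, so every allowed position is a maximizer.
  refine (Computable.attend M (ι := Empty) (q := fun _ => f) (κ := fun _ => f) (fun _ => hf)
    (fun _ => hf) hf).congr fun n a p => ?_
  simp [attend_zero_score]

/-- The average over all positions. -/
lemma average (hf : Computable σ f) :
    Computable σ fun n a _ => ((n : ℝ) + 1)⁻¹ * ∑ r, f n a r :=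
  (hf.attend_uniform .none).congr fun n a p => by simp [Mask.allowed]

/-- The average over the positions up to the present one. -/
lemma prefixAverage (hf : Computable σ f) : Computable σ fun n a p =>
    ((p.val : ℝ) + 1)⁻¹ * ∑ r with r ≤ p, f n a r :=
  (hf.attend_uniform .future).congr fun n a p => by
    have : (Finset.univ.filter fun r : Fin (n + 1) => r ≤ p).card = p.val + 1 := by
      rw [show (Finset.univ.filter fun r : Fin (n + 1) => r ≤ p) = Finset.Iic p by ext; simp,
        Fin.card_Iic]
    simp [Mask.allowed, this]

/-- The indicator of the string positions. -/
lemma string : Computable σ fun _ _ p => if p = 0 then 0 else 1 := by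
  -- Only the default position has no strict predecessor; there the empty average is 0.
  refine (Computable.one.attend_uniform .strictFuture).congr fun n a p => ?_
  split_ifs with h
  · subst h
    simp [Mask.allowed]
  · have h0 : 0 < p := Fin.pos_of_ne_zero h
    have : ((Mask.strictFuture.allowed p).card : ℝ) ≠ 0 :=
      Nat.cast_ne_zero.2 (Finset.card_ne_zero_of_mem (a := 0) (by simpa using h0))
    rw [Finset.sum_const, nsmul_eq_mul, mul_one, inv_mul_cancel₀ this]

/-- The indicator of the default position. -/
lemma default : Computable σ fun _ _ p => if p = 0 then 1 else 0 :=
  (Computable.one.sub string).congr fun n a p => by split_ifs <;> simp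

/-- The value at the default position, at all positions. -/
lemma atDefault (hf : Computable σ f) : Computable σ fun n a _ => f n a 0 := by
  refine (Computable.attend .none (ι := Unit) (fun _ => Computable.one) (fun _ => default)
    hf).congr fun n a p => ?_
  symm
  refine attend_eq ⟨0, by simp⟩ fun r _ hr => ?_
  have := hr 0 (by simp)
  by_cases h : r = 0
  · rw [h]
  · norm_num [h] at this

/-- The value at the default position, at all string positions. -/
lemma atDefault_string (hf : Computable σ f) :
    Computable σ fun n a p => if p = 0 then 0 else f n a 0 := by
  refine (Computable.attend .strictFuture (ι := Unit) (fun _ => Computable.one)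
    (fun _ => default) hf).congr fun n a p => ?_
  split_ifs with h
  · subst h
    simp [AHAT.attend, Mask.allowed]
  · have h0 : 0 < p := Fin.pos_of_ne_zero h
    symm
    refine attend_eq ⟨0, by simpa using h0⟩ fun r _ hr => ?_
    have := hr 0 (by simpa using h0)
    by_cases h : r = 0
    · rw [h]
    · norm_num [h] at this

/-- Replacing the value at the default position by `0`. -/
lemma restrict (hf : Computable σ f) :
    Computable σ fun n a p => if p = 0 then 0 else f n a p :=
  -- Avoids multiplying by an indicator: the default value is removed everywhere and restored at
  -- string positions only.
  ((hf.sub hf.atDefault).add hf.atDefault_string).congr fun n a p => by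
    split_ifs with h
    · simp [h]
    · ring

end Computable

/-! ### Functions on string positions -/

/-- A real-valued function of the input vector and of a string position. -/
abbrev StringFeature (A : Type*) : Type _ := ∀ n : ℕ, (Fin n → Option A) → Fin n → ℝ

/-- The function extended by `0` to the default position is computable. -/
def Comp {A : Type*} {k : ℕ} (σ : Option A ≃ Fin k) (g : StringFeature A) : Prop :=
  Computable σ fun n a p => Fin.cases (0 : ℝ) (g n a) p

/-- Sums of products of functions of `i` and functions of `j`. -/
inductive Bilin {A : Type*} {k : ℕ} (σ : Option A ≃ Fin k) :
    (∀ n : ℕ, (Fin n → Option A) → Fin n → Fin n → ℝ) → Prop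
  | mul {q κ : StringFeature A} : Comp σ q → Comp σ κ →
      Bilin σ fun n a i j => q n a i * κ n a j
  | add {S S' : ∀ n : ℕ, (Fin n → Option A) → Fin n → Fin n → ℝ} : Bilin σ S → Bilin σ S' →
      Bilin σ fun n a i j => S n a i j + S' n a i j

namespace Comp

variable {A : Type*} {k : ℕ} {σ : Option A ≃ Fin k} {g h : StringFeature A}

lemma of_computable {f : Feature A} (hf : Computable σ f) (h : ∀ n a i, g n a i = f n a i.succ) :
    Comp σ g :=
  hf.restrict.congr fun n a p => by
    refine Fin.cases ?_ (fun i => ?_) p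
    · simp
    · simp [h]

lemma congr (hg : Comp σ g) (hh : ∀ n a i, h n a i = g n a i) : Comp σ h :=
  of_computable hg hh

lemma const (c : ℝ) : Comp σ fun _ _ _ => c := of_computable (.const c) fun _ _ _ => rfl

lemma add (hg : Comp σ g) (hh : Comp σ h) : Comp σ fun n a i => g n a i + h n a i :=
  of_computable (Computable.add hg hh) fun _ _ _ => rfl

lemma sub (hg : Comp σ g) (hh : Comp σ h) : Comp σ fun n a i => g n a i - h n a i :=
  of_computable (Computable.sub hg hh) fun _ _ _ => rfl

lemma smul (c : ℝ) (hg : Comp σ g) : Comp σ fun n a i => c * g n a i :=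
  of_computable (Computable.smul c hg) fun _ _ _ => rfl

lemma relu (hg : Comp σ g) : Comp σ fun n a i => max 0 (g n a i) :=
  of_computable (Computable.relu hg) fun _ _ _ => rfl

lemma min (hg : Comp σ g) (hh : Comp σ h) : Comp σ fun n a i => Min.min (g n a i) (h n a i) :=
  (hg.sub (hg.sub hh).relu).congr fun n a i => by
    rcases le_total (g n a i) (h n a i) with hl | hl
    · rw [min_eq_left hl, max_eq_left (by linarith)]; ring
    · rw [min_eq_right hl, max_eq_right (by linarith)]; ring

lemma sum {ι : Type*} (s : Finset ι) {g : ι → StringFeature A} (hg : ∀ t, Comp σ (g t)) :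
    Comp σ fun n a i => ∑ t ∈ s, g t n a i := by
  classical
  induction s using Finset.induction_on with
  | empty => simpa using const 0
  | insert t s ht ih => simpa [Finset.sum_insert ht] using (hg t).add ih

/-! ### Input symbols, positions and powers of the length -/

lemma input (c : Fin k) : Comp σ fun _ a i => if σ (a i) = c then 1 else 0 :=
  of_computable (.input c) fun _ _ _ => rfl

lemma pos : Comp σ fun n _ i => (i.val : ℝ) / n :=
  of_computable .pos fun _ _ _ => by simp

/-- The default position is numbered -1, so its position encoding is -1/n. -/
lemma inv_length : Comp σ fun n _ _ => 1 / (n : ℝ) :=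
  of_computable (Computable.pos.atDefault.smul (-1)) fun n _ _ => by simp [neg_div]

lemma inv_pos_sq : Comp σ fun _ _ i => 1 / ((i.val : ℝ) + 2) ^ 2 :=
  of_computable .invSq fun _ _ _ => by simp

/-- Functions that depend only on the length can be divided by `n + 1`. -/
lemma div_length {z : ℕ → ℝ} (hz : Computable σ fun n _ _ => z n) :
    Computable σ fun n _ _ => z n / ((n : ℝ) + 1) :=
  -- The averaged function is z n at the default position and 0 at the n others.
  (hz.sub hz.restrict).average.congr fun n a p => by
    simp only [Fin.sum_univ_succ, Fin.succ_ne_zero]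
    simp [div_eq_inv_mul]

lemma inv_length_pow (m : ℕ) : Comp σ fun n _ _ => 1 / ((n : ℝ) + 1) ^ m := by
  suffices h : Computable σ fun n _ _ => 1 / ((n : ℝ) + 1) ^ m from
    of_computable h fun _ _ _ => rfl
  induction m with
  | zero => simpa using Computable.one
  | succ m ih => exact (div_length ih).congr fun n _ _ => by rw [pow_succ, div_div]

/-- Prefix sums are available up to a factor `i + 2`. -/
lemma prefixAverage (hg : Comp σ g) {z : ℕ → ℝ} (hz : Computable σ fun n _ _ => z n) :
    Comp σ fun n a i => (z n + ∑ j with j ≤ i, g n a j) / ((i.val : ℝ) + 2) :=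
  -- The default position contributes z n, and the positions -1, …, i number i + 2.
  of_computable (Computable.add hg (hz.sub hz.restrict)).prefixAverage fun n a i => by
    rw [Finset.sum_filter, Finset.sum_filter, Fin.sum_univ_succ]
    simp [div_eq_inv_mul, add_assoc, one_add_one_eq_two]

lemma inv_pos : Comp σ fun _ _ i => 1 / ((i.val : ℝ) + 2) :=
  (prefixAverage (const 0) Computable.one).congr fun _ _ _ => by simp

end Comp

namespace Bilin

variable {A : Type*} {k : ℕ} {σ : Option A ≃ Fin k}
  {S S' : ∀ n : ℕ, (Fin n → Option A) → Fin n → Fin n → ℝ} {g : StringFeature A}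

lemma congr (hS : Bilin σ S) (h : ∀ n a i j, S' n a i j = S n a i j) : Bilin σ S' := by
  have : S' = S := by
    funext n a i j
    exact h n a i j
  exact this ▸ hS

lemma left (hg : Comp σ g) : Bilin σ fun n a i _ => g n a i :=
  (mul hg (.const 1)).congr fun _ _ _ _ => (mul_one _).symm

lemma right (hg : Comp σ g) : Bilin σ fun n a _ j => g n a j :=
  (mul (.const 1) hg).congr fun _ _ _ _ => (one_mul _).symm

lemma smul (c : ℝ) (hS : Bilin σ S) : Bilin σ fun n a i j => c * S n a i j := by
  induction hS with
  | mul hq hκ => exact (mul (hq.smul c) hκ).congr fun _ _ _ _ => by ring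
  | add _ _ ih ih' => exact (ih.add ih').congr fun _ _ _ _ => by ring

lemma sub (hS : Bilin σ S) (hS' : Bilin σ S') : Bilin σ fun n a i j => S n a i j - S' n a i j :=
  (hS.add (hS'.smul (-1))).congr fun _ _ _ _ => by ring

lemma exists_sum (hS : Bilin σ S) : ∃ (ι : Type) (_ : Fintype ι) (q κ : ι → StringFeature A),
    (∀ t, Comp σ (q t)) ∧ (∀ t, Comp σ (κ t)) ∧
      ∀ n a i j, S n a i j = ∑ t, q t n a i * κ t n a j := by
  induction hS with
  | @mul q κ hq hκ => exact ⟨Unit, inferInstance, fun _ => q, fun _ => κ, fun _ => hq, fun _ => hκ,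
      by simp⟩
  | add _ _ ih ih' =>
    obtain ⟨ι, _, q, κ, hq, hκ, h⟩ := ih
    obtain ⟨ι', _, q', κ', hq', hκ', h'⟩ := ih'
    refine ⟨ι ⊕ ι', inferInstance, Sum.elim q q', Sum.elim κ κ', ?_, ?_, ?_⟩
    · rintro (t | t)
      exacts [hq t, hq' t]
    · rintro (t | t)
      exacts [hκ t, hκ' t]
    · intro n a i j
      simp [h, h']

end Bilin

namespace Comp

variable {A : Type*} {k : ℕ} {σ : Option A ≃ Fin k} {g h : StringFeature A}

/-- Attention among string positions, the default position having score `θ`: if some string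
position scores above `θ`, all those of maximal score must hold the value `g`; if all score
below `θ`, the value is `0`. -/
lemma select (M : Mask) {S : ∀ n : ℕ, (Fin n → Option A) → Fin n → Fin n → ℝ}
    {θ v : StringFeature A} (hS : Bilin σ S) (hθ : Comp σ θ) (hv : Comp σ v)
    (h : ∀ n a i,
      (∃ j : Fin n, j.succ ∈ M.allowed i.succ ∧ θ n a i < S n a i j ∧
        ∀ j : Fin n, j.succ ∈ M.allowed i.succ →
          (∀ j' : Fin n, j'.succ ∈ M.allowed i.succ → S n a i j' ≤ S n a i j) →
            v n a j = g n a i) ∨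
      ((∀ j : Fin n, j.succ ∈ M.allowed i.succ → S n a i j < θ n a i) ∧ g n a i = 0)) :
    Comp σ g := by
  obtain ⟨ι, _, q, κ, hq, hκ, hSum⟩ := hS.exists_sum
  -- The extra summand `none` pairs θ(i) with the indicator of the default position; the others
  -- vanish there.
  have hq' : ∀ t : Option ι, Computable σ (t.elim (fun n a p => Fin.cases (0 : ℝ) (θ n a) p)
      fun t n a p => Fin.cases (0 : ℝ) (q t n a) p) := by
    rintro (_ | t)
    exacts [hθ, hq t]
  have hκ' : ∀ t : Option ι, Computable σ (t.elim (fun n a p => if p = 0 then 1 else 0)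
      fun t n a p => Fin.cases (0 : ℝ) (κ t n a) p) := by
    rintro (_ | t)
    exacts [.default, hκ t]
  refine of_computable (Computable.attend M hq' hκ' hv) fun n a i => ?_
  symm
  refine attend_eq ⟨0, M.zero_mem_allowed i⟩ fun r hr hmax => ?_
  simp only [Fintype.sum_option] at hmax
  rcases h n a i with ⟨j, hj, hjS, hval⟩ | ⟨hlt, h0⟩
  · obtain rfl | ⟨r, rfl⟩ := Fin.eq_zero_or_eq_succ r
    · have := hmax _ hj
      simp [← hSum] at this
      linarith
    · refine hval r hr fun j' hj' => ?_
      have := hmax _ hj'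
      simpa [← hSum] using this
  · obtain rfl | ⟨r, rfl⟩ := Fin.eq_zero_or_eq_succ r
    · simp [h0]
    · have := hmax 0 (M.zero_mem_allowed i)
      simp [← hSum] at this
      linarith [hlt r hr]

/-- The sign of a function without zeros. -/
lemma isPos (hg : Comp σ g) (h0 : ∀ n a i, g n a i ≠ 0) :
    Comp σ fun n a i => if 0 < g n a i then 1 else 0 := by
  -- All string positions score g(i) against the threshold 0; the absence of zeros excludes a tie.
  refine select .none (.left hg) (const 0) (const 1) fun n a i => ?_
  by_cases hp : 0 < g n a i
  · left
    exact ⟨i, by simp [hp]⟩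
  · right
    simp [hp, lt_of_le_of_ne (not_lt.1 hp) (h0 n a i)]

/-- The value at the position `min x (n - 1)`, for `x` given up to a positive factor. -/
lemma lookup_min {l v : StringFeature A} {x : ∀ n : ℕ, (Fin n → Option A) → Fin n → ℕ}
    (hl : Comp σ l) (hpos : ∀ n a i, 0 < l n a i)
    (hx : Comp σ fun n a i => l n a i * (x n a i + 2)) (hv : Comp σ v)
    (h : ∀ n a i, ∃ j : Fin n, j.val = Min.min (x n a i) (n - 1) ∧ g n a i = v n a j) :
    Comp σ g := by
  -- With y = 1/(j+2) the score is l(2y - (x+2)y²). The threshold -l(x+2) lies below it since 0 < y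
  -- ≤ 1.
  refine select .none (((Bilin.mul hl inv_pos).smul 2).sub (Bilin.mul hx inv_pos_sq))
    (hx.smul (-1)) hv fun n a i => Or.inl ?_
  obtain ⟨m, hm, hg⟩ := h n a i
  have hln := hpos n a i
  have hX : (0 : ℝ) ≤ x n a i := Nat.cast_nonneg _
  refine ⟨m, by simp, ?_, fun j _ hj => ?_⟩
  · have h1 : (0 : ℝ) < 1 / ((m.val : ℝ) + 2) := by positivity
    have h2 : 1 / ((m.val : ℝ) + 2) ^ 2 ≤ 1 := by
      rw [div_le_one (by positivity)]
      nlinarith [(Nat.cast_nonneg m.val : (0 : ℝ) ≤ m.val)]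
    have h3 : 0 < l n a i * (x n a i + 2) := by positivity
    nlinarith [mul_pos hln h1]
  · suffices hjm : j = m by rw [hjm, hg]
    by_contra hne
    have hne' : j.val ≠ m.val := fun h => hne (Fin.ext h)
    have hjm := hj m (by simp)
    have hjn := j.isLt
    set X : ℝ := ((x n a i : ℕ) : ℝ)
    have e1 : ∀ t : Fin n, 1 / ((t.val : ℝ) + 2) ^ 2 = (1 / ((t.val : ℝ) + 2)) ^ 2 :=
      fun t => by rw [one_div_pow]
    have hy : ∀ t : Fin n, 1 / ((t.val : ℝ) + 2) * ((t.val : ℝ) + 2) = 1 :=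
      fun t => by field_simp
    rw [e1, e1] at hjm
    have hym := hy m
    have hyj := hy j
    have hm0 : (0 : ℝ) < 1 / ((m.val : ℝ) + 2) := by positivity
    have hj0 : (0 : ℝ) < 1 / ((j.val : ℝ) + 2) := by positivity
    generalize 1 / ((m.val : ℝ) + 2) = ym at *
    generalize 1 / ((j.val : ℝ) + 2) = yj at *
    -- This is the score difference between m and j divided by l. If j < m then m ≤ X and both
    -- factors are negative; if j > m then m = X and both are positive.
    have key : 0 < (ym - yj) * (2 - (X + 2) * (ym + yj)) := by
      rcases lt_or_gt_of_ne hne' with hlt | hlt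
      · have hmx : m.val ≤ x n a i := by omega
        have hlt' : (j.val : ℝ) < m.val := by exact_mod_cast hlt
        have hmx' : (m.val : ℝ) ≤ X := Nat.cast_le.2 hmx
        have h1 : 1 < (X + 2) * yj := by nlinarith
        have h2 : 1 ≤ (X + 2) * ym := by nlinarith
        have h3 : ym < yj := by
          by_contra hc
          nlinarith
        nlinarith
      · have hmx : m.val = x n a i := by omega
        have hlt' : (m.val : ℝ) < j.val := by exact_mod_cast hlt
        have hmx' : (m.val : ℝ) = X := congrArg Nat.cast hmx
        have h1 : (X + 2) * yj < 1 := by nlinarith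
        have h2 : (X + 2) * ym = 1 := by rw [← hmx']; linarith
        have h3 : yj < ym := by
          by_contra hc
          nlinarith
        nlinarith
    nlinarith [mul_pos hln key]

/-- Composition with a position. -/
lemma lookup {x : ∀ n : ℕ, (Fin n → Option A) → Fin n → Fin n}
    (hx : Comp σ fun n a i => ((x n a i).val : ℝ) / n) (hg : Comp σ g) :
    Comp σ fun n a i => g n a (x n a i) := by
  refine lookup_min (x := fun n a i => (x n a i).val) inv_length (fun n a i => ?_)
    ((hx.add (inv_length.smul 2)).congr fun n a i => by ring) hg fun n a i =>
      ⟨x n a i, by have := (x n a i).isLt; omega, rfl⟩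
  have : (0 : ℝ) < n := by exact_mod_cast i.pos
  positivity

/-- Clipped prefix sums. -/
lemma prefixSum {V : ∀ n : ℕ, (Fin n → Option A) → Fin n → ℕ}
    (hV : Comp σ fun n a i => (V n a i : ℝ) / n) :
    Comp σ fun n a i => ((Min.min (∑ j with j ≤ i, V n a j) (n - 1) : ℕ) : ℝ) / n := by
  have hN : Computable σ fun n _ _ => 1 / (n : ℝ) :=
    (Computable.pos.atDefault.smul (-1)).congr fun n _ _ => by simp [neg_div]
  -- The factor l is 1/(n(i+2)); placing 2/n at the default position supplies the summand 2 in l(x +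
  -- 2). Looking up the position encoding then returns the clipped sum over n.
  refine lookup_min (x := fun n a i => ∑ j with j ≤ i, V n a j) (v := fun n _ i => (i.val : ℝ) / n)
    (prefixAverage (const 0) hN) (fun n a i => ?_)
    ((prefixAverage hV (hN.smul 2)).congr fun n a i => ?_) pos fun n a i => ?_
  · have : (0 : ℝ) < n := by exact_mod_cast i.pos
    simp only [Finset.sum_const_zero, add_zero]
    positivity
  · rw [← Finset.sum_div]
    push_cast
    simp only [Finset.sum_const_zero]
    ring
  · have := i.pos
    exact ⟨⟨_, lt_of_le_of_lt (Nat.min_le_right _ _) (by omega)⟩, rfl, rfl⟩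

end Comp

/-! ### Leftmost and rightmost attention -/

/-- A predicate that can be tested by attention scores, with a margin `δ`. -/
def Attendable {A : Type*} {k : ℕ} (σ : Option A ≃ Fin k)
    (P : ∀ n : ℕ, (Fin n → Option A) → Fin n → Fin n → Prop) : Prop :=
  ∃ S δ, Bilin σ S ∧ Comp σ δ ∧ ∀ n a i j, 0 < δ n a i ∧ (P n a i j → S n a i j = 0) ∧
    (¬ P n a i j → S n a i j ≤ - δ n a i)

/-- The position chosen from a set. -/
def IsChoice {n : ℕ} : SRASP.Choice → Set (Fin n) → Fin n → Prop
  | .leftmost, s, j => IsLeast s j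
  | .rightmost, s, j => IsGreatest s j

variable {A : Type*} {k : ℕ} {σ : Option A ≃ Fin k} {g v : StringFeature A}
  {P : ∀ n : ℕ, (Fin n → Option A) → Fin n → Fin n → Prop}

lemma Attendable.comp_choice (hP : Attendable σ P) (c : SRASP.Choice) (M : Mask) (hv : Comp σ v)
    (h : ∀ n a i, (∃ j, IsChoice c {j | j.succ ∈ M.allowed i.succ ∧ P n a i j} j ∧
        g n a i = v n a j) ∨
      ((∀ j : Fin n, j.succ ∈ M.allowed i.succ → ¬ P n a i j) ∧ g n a i = 0)) :
    Comp σ g := by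
  obtain ⟨S, δ, hS, hδ, hSδ⟩ := hP
  obtain ⟨ε, hε, hεc⟩ : ∃ ε : ℝ, |ε| = 1 ∧ ∀ {n : ℕ} {s : Set (Fin n)} {j : Fin n},
      IsChoice c s j → j ∈ s ∧ ∀ j' ∈ s, ε * (j.val : ℝ) ≤ ε * j'.val → j' = j := by
    cases c with
    | leftmost =>
      refine ⟨-1, by simp, @fun n s j h => ⟨h.1, fun j' hj' hle => le_antisymm ?_ (h.2 hj')⟩⟩
      have : (j'.val : ℝ) ≤ j.val := by linarith
      exact_mod_cast this
    | rightmost =>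
      refine ⟨1, by simp, @fun n s j h => ⟨h.1, fun j' hj' hle => le_antisymm (h.2 hj') ?_⟩⟩
      have : (j.val : ℝ) ≤ j'.val := by linarith
      exact_mod_cast this
  have hb : ∀ n a (i j : Fin n), |ε / 4 * (δ n a i * ((j.val : ℝ) / n))| ≤ δ n a i / 4 := by
    intro n a i j
    have hn : (0 : ℝ) < n := by exact_mod_cast i.pos
    have h1 : (j.val : ℝ) / n ≤ 1 := by
      rw [div_le_one hn]
      exact_mod_cast j.isLt.le
    have h0 : 0 ≤ (j.val : ℝ) / n := by positivity
    have hd := (hSδ n a i j).1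
    rw [abs_mul, abs_div, hε, abs_of_pos (show (0 : ℝ) < 4 by norm_num),
      abs_of_nonneg (by positivity)]
    nlinarith
  -- The tie-breaking term is at most δ/4 in size: qualifying positions score at least -δ/4, the
  -- others at most -3δ/4, and the threshold -δ/2 separates them.
  refine Comp.select M (hS.add ((Bilin.mul hδ Comp.pos).smul (ε / 4))) (hδ.smul (-1 / 2)) hv
    fun n a i => ?_
  rcases h n a i with ⟨j, hj, hg⟩ | ⟨hn, h0⟩
  · left
    obtain ⟨⟨hja, hjP⟩, hjm⟩ := hεc hj
    have hθ : -1 / 2 * δ n a i < S n a i j + ε / 4 * (δ n a i * ((j.val : ℝ) / n)) := by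
      have := (hSδ n a i j).1
      rw [(hSδ n a i j).2.1 hjP]
      linarith [(abs_le.1 (hb n a i j)).1]
    refine ⟨j, hja, hθ, fun j' hja' hj' => ?_⟩
    have hle := hj' j hja
    have hd := (hSδ n a i j).1
    have hP' : P n a i j' := by
      by_contra hc
      linarith [(hSδ n a i j').2.2 hc, (abs_le.1 (hb n a i j')).2]
    rw [(hSδ n a i j).2.1 hjP, (hSδ n a i j').2.1 hP'] at hle
    rw [hg, hjm j' ⟨hja', hP'⟩]
    have hnp : (0 : ℝ) < n := by exact_mod_cast i.pos
    have hc : 0 < δ n a i / (4 * n) := by positivity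
    refine le_of_mul_le_mul_left (a := δ n a i / (4 * n)) ?_ hc
    calc _ = 0 + ε / 4 * (δ n a i * ((j.val : ℝ) / n)) := by ring
      _ ≤ _ := hle
      _ = _ := by ring
  · right
    refine ⟨fun j hj => ?_, h0⟩
    have := (hSδ n a i j).1
    linarith [(hSδ n a i j).2.2 (hn j hj), (abs_le.1 (hb n a i j)).2]

/-! ### Past masks by reversal of positions -/

lemma Comp.rev (hg : Comp σ g) : Comp σ fun n a i => g n a i.rev :=
  Comp.lookup (x := fun _ _ i => i.rev)
    ((((Comp.const 1).sub Comp.inv_length).sub Comp.pos).congr fun n a i => by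
      have : (n : ℝ) ≠ 0 := by exact_mod_cast i.pos.ne'
      rw [Fin.val_rev, Nat.cast_sub (by omega)]
      push_cast
      field_simp
      ring) hg

lemma Bilin.rev {S : ∀ n : ℕ, (Fin n → Option A) → Fin n → Fin n → ℝ} (hS : Bilin σ S) :
    Bilin σ fun n a i j => S n a i.rev j.rev := by
  induction hS with
  | mul hq hκ => exact .mul hq.rev hκ.rev
  | add _ _ ih ih' => exact ih.add ih'

lemma Attendable.rev (hP : Attendable σ P) : Attendable σ fun n a i j => P n a i.rev j.rev := by
  obtain ⟨S, δ, hS, hδ, h⟩ := hP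
  exact ⟨_, _, hS.rev, hδ.rev, fun n a i j => h n a i.rev j.rev⟩

/-- The opposite choice. -/
def opposite : SRASP.Choice → SRASP.Choice
  | .leftmost => .rightmost
  | .rightmost => .leftmost

lemma IsChoice.rev {n : ℕ} {c : SRASP.Choice} {s : Set (Fin n)} {j : Fin n}
    (h : IsChoice c s j) : IsChoice (opposite c) {j | j.rev ∈ s} j.rev := by
  cases c with
  | leftmost =>
    exact ⟨by simpa using h.1, fun j' hj' => by simpa using Fin.rev_le_rev.2 (h.2 hj')⟩
  | rightmost =>
    exact ⟨by simpa using h.1, fun j' hj' => by simpa using Fin.rev_le_rev.2 (h.2 hj')⟩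

/-- Leftmost and rightmost attention with value `0` when no position qualifies. -/
lemma Attendable.comp_attn (hP : Attendable σ P) (c : SRASP.Choice) (M : SRASP.Mask)
    (hv : Comp σ v)
    (h : ∀ n a i, (∃ j, IsChoice c {j | M.test i j = true ∧ P n a i j} j ∧ g n a i = v n a j) ∨
      ((∀ j : Fin n, M.test i j = true → ¬ P n a i j) ∧ g n a i = 0)) :
    Comp σ g := by
  cases M with
  | none => exact hP.comp_choice c .none hv (by simpa [SRASP.Mask.test] using h)
  | lt => exact hP.comp_choice c .strictFuture hv (by simpa [SRASP.Mask.test] using h)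
  | le => exact hP.comp_choice c .future hv (by simpa [SRASP.Mask.test] using h)
  | gt =>
    -- Encoders have no past masks. Reversal turns j > i into j < i and exchanges leftmost and
    -- rightmost; reversing the result undoes it.
    suffices h' : Comp σ fun n a i => g n a i.rev from h'.rev.congr fun n a i => by simp
    refine hP.rev.comp_choice (opposite c) .strictFuture hv.rev fun n a i => ?_
    rcases h n a i.rev with ⟨j, hj, hg⟩ | ⟨hn, h0⟩
    · left
      refine ⟨j.rev, ?_, by simpa using hg⟩
      convert hj.rev using 2
      ext j
      simp [SRASP.Mask.test]
    · right
      refine ⟨fun j hj => hn _ ?_, h0⟩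
      simpa [SRASP.Mask.test] using hj
  | ge =>
    suffices h' : Comp σ fun n a i => g n a i.rev from h'.rev.congr fun n a i => by simp
    refine hP.rev.comp_choice (opposite c) .future hv.rev fun n a i => ?_
    rcases h n a i.rev with ⟨j, hj, hg⟩ | ⟨hn, h0⟩
    · left
      refine ⟨j.rev, ?_, by simpa using hg⟩
      convert hj.rev using 2
      ext j
      simp [SRASP.Mask.test]
    · right
      refine ⟨fun j hj => hn _ ?_, h0⟩
      simpa [SRASP.Mask.test] using hj

/-! ### Boolean functions -/

/-- The real number encoding a truth value. -/
def ofBool (b : Bool) : ℝ := bif b then 1 else 0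

lemma ofBool_decide (p : Prop) [Decidable p] : ofBool (decide p) = if p then 1 else 0 := by
  by_cases h : p <;> simp [ofBool, h]

lemma ofBool_not (b : Bool) : ofBool (Bool.not b) = 1 - ofBool b := by cases b <;> simp [ofBool]

lemma ofBool_and (b c : Bool) : ofBool (Bool.and b c) = ofBool b * ofBool c := by
  cases b <;> cases c <;> simp [ofBool]

lemma ofBool_and_eq_max (b c : Bool) :
    ofBool (Bool.and b c) = max 0 (ofBool b + ofBool c - 1) := by
  cases b <;> cases c <;> simp [ofBool]

lemma ofBool_or (b c : Bool) :
    ofBool (Bool.or b c) = ofBool b + ofBool c - ofBool b * ofBool c := by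
  cases b <;> cases c <;> simp [ofBool]

/-- A family of functions on the string positions. -/
abbrev StringFun (A : Type*) (R : Type) : Type _ := ∀ n : ℕ, (Fin n → Option A) → Fin n → R

/-- The Boolean function is computable. -/
def CompBool {A : Type*} {k : ℕ} (σ : Option A ≃ Fin k) (b : StringFun A Bool) : Prop :=
  Comp σ fun n a i => ofBool (b n a i)

section

variable {A : Type*} {k : ℕ} {σ : Option A ≃ Fin k} {b c : StringFun A Bool}
  {x y : StringFun A ℕ}

lemma CompBool.const (t : Bool) : CompBool σ fun _ _ _ => t := Comp.const _

lemma CompBool.not (hb : CompBool σ b) : CompBool σ fun n a i => Bool.not (b n a i) :=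
  ((Comp.const 1).sub hb).congr fun _ _ _ => ofBool_not _

lemma CompBool.and (hb : CompBool σ b) (hc : CompBool σ c) :
    CompBool σ fun n a i => Bool.and (b n a i) (c n a i) :=
  ((hb.add hc).sub (Comp.const 1)).relu.congr fun _ _ _ => ofBool_and_eq_max _ _

lemma CompBool.or (hb : CompBool σ b) (hc : CompBool σ c) :
    CompBool σ fun n a i => Bool.or (b n a i) (c n a i) :=
  Comp.congr (hb.not.and hc.not).not fun n a i => by
    simp only [ofBool_not, ofBool_and, ofBool_or]
    ring

/-- For integers, y - x - 1/2 is never 0 and is positive exactly when x < y, so `Comp.isPos`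
applies. -/
lemma CompBool.lt (hx : Comp σ fun n a i => (x n a i : ℝ) / n)
    (hy : Comp σ fun n a i => (y n a i : ℝ) / n) :
    CompBool σ fun n a i => decide (x n a i < y n a i) := by
  have key : ∀ n (a : Fin n → Option A) (i : Fin n),
      ((y n a i : ℝ) / n - x n a i / n - 1 / 2 * (1 / n)) =
        (((2 * (y n a i) - 2 * (x n a i) - 1 : ℤ) : ℝ)) / (2 * n) := by
    intro n a i
    push_cast
    ring
  have hn : ∀ n (_ : Fin n), (0 : ℝ) < 2 * n := fun n i => by
    have : (0 : ℝ) < n := by exact_mod_cast i.pos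
    positivity
  refine (Comp.isPos ((hy.sub hx).sub (Comp.inv_length.smul (1 / 2))) fun n a i => ?_).congr
    fun n a i => ?_
  · rw [key]
    refine div_ne_zero ?_ (hn n i).ne'
    rw [Int.cast_ne_zero]
    omega
  · rw [key, ofBool_decide]
    refine if_congr ?_ rfl rfl
    rw [lt_div_iff₀ (hn n i), zero_mul, Int.cast_pos]
    omega

lemma CompBool.le (hx : Comp σ fun n a i => (x n a i : ℝ) / n)
    (hy : Comp σ fun n a i => (y n a i : ℝ) / n) :
    CompBool σ fun n a i => decide (x n a i ≤ y n a i) :=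
  Comp.congr (CompBool.lt hy hx).not fun n a i => by
    simp only [← not_lt, decide_not]

lemma CompBool.cmp (op : SRASP.Cmp) (hx : Comp σ fun n a i => (x n a i : ℝ) / n)
    (hy : Comp σ fun n a i => (y n a i : ℝ) / n) :
    CompBool σ fun n a i => op.test (x n a i) (y n a i) := by
  have heq : CompBool σ fun n a i => decide (x n a i = y n a i) :=
    Comp.congr ((CompBool.le hx hy).and (CompBool.le hy hx)) fun n a i => by
      congr 1
      simp [le_antisymm_iff]
  cases op with
  | eq => exact heq
  | ne => exact Comp.congr heq.not fun n a i => by simp [SRASP.Cmp.test]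
  | lt => exact .lt hx hy
  | le => exact .le hx hy
  | gt => exact .lt hy hx
  | ge => exact .le hy hx

/-- For values in [0, 1], ReLU replaces multiplication by a truth value: max 0 (g + c - 1) is g or
0, and max 0 (h - c) is 0 or h. -/
lemma Comp.cond {g h : StringFeature A} (hc : CompBool σ c) (hg : Comp σ g) (hh : Comp σ h)
    (hg' : ∀ n a i, 0 ≤ g n a i ∧ g n a i ≤ 1) (hh' : ∀ n a i, 0 ≤ h n a i ∧ h n a i ≤ 1) :
    Comp σ fun n a i => bif c n a i then g n a i else h n a i :=
  (((hg.add hc).sub (Comp.const 1)).relu.add (hh.sub hc).relu).congr fun n a i => by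
    have h1 := hg' n a i
    have h2 := hh' n a i
    cases c n a i
    · simp only [ofBool, cond_false]
      rw [max_eq_left (by linarith), max_eq_right (by linarith)]
      ring
    · simp only [ofBool, cond_true]
      rw [max_eq_right (by linarith), max_eq_left (by linarith)]
      ring

/-- Attention with default values. -/
lemma Attendable.comp_attn_default
    {P : ∀ n : ℕ, (Fin n → Option A) → Fin n → Fin n → Prop} (hP : Attendable σ P)
    (c : SRASP.Choice) (M : SRASP.Mask) {g v d : StringFeature A} (hv : Comp σ v) (hd : Comp σ d)
    (hd' : ∀ n a i, 0 ≤ d n a i ∧ d n a i ≤ 1)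
    (h : ∀ n a i, (∃ j, IsChoice c {j | M.test i j = true ∧ P n a i j} j ∧ g n a i = v n a j) ∨
      ((∀ j : Fin n, M.test i j = true → ¬ P n a i j) ∧ g n a i = d n a i)) :
    Comp σ g := by
  classical
  let E : ∀ n : ℕ, (Fin n → Option A) → Fin n → Prop := fun n a i =>
    ∃ j, IsChoice c {j | M.test i j = true ∧ P n a i j} j
  have hE : ∀ n a i, (∀ j : Fin n, M.test i j = true → ¬ P n a i j) → ¬ E n a i := by
    rintro n a i hn ⟨j, hj⟩
    cases c
    exacts [hn j hj.1.1 hj.1.2, hn j hj.1.1 hj.1.2]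
  -- The attention is run twice, for the value and for a flag of success. Since 0 ≤ d ≤ 1, max 0 (d
  -- - flag) adds the default exactly on failure.
  have hw : Comp σ fun n a i => if E n a i then g n a i else 0 :=
    hP.comp_attn c M hv fun n a i => by
      rcases h n a i with ⟨j, hj, hg⟩ | ⟨hn, -⟩
      · exact Or.inl ⟨j, hj, by rw [if_pos ⟨j, hj⟩, hg]⟩
      · exact Or.inr ⟨hn, if_neg (hE n a i hn)⟩
  have hf : Comp σ fun n a i => if E n a i then 1 else 0 :=
    hP.comp_attn c M (Comp.const 1) fun n a i => by
      rcases h n a i with ⟨j, hj, hg⟩ | ⟨hn, -⟩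
      · exact Or.inl ⟨j, hj, if_pos ⟨j, hj⟩⟩
      · exact Or.inr ⟨hn, if_neg (hE n a i hn)⟩
  refine (hw.add (hd.sub hf).relu).congr fun n a i => ?_
  have := hd' n a i
  rcases h n a i with ⟨j, hj, hg⟩ | ⟨hn, hg⟩
  · rw [if_pos ⟨j, hj⟩, if_pos ⟨j, hj⟩, max_eq_left (by linarith), add_zero]
  · rw [if_neg (hE n a i hn), if_neg (hE n a i hn), max_eq_right (by linarith), hg]
    ring

/-! ### Predicates of two positions -/

/-- Linear combinations of products of a Boolean function of `i` and one of `j`. -/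
inductive BoolBilin (σ : Option A ≃ Fin k) :
    (∀ n : ℕ, (Fin n → Option A) → Fin n → Fin n → ℝ) → Prop
  | mul (r : ℝ) {b c : StringFun A Bool} : CompBool σ b → CompBool σ c →
      BoolBilin σ fun n a i j => r * (ofBool (b n a i) * ofBool (c n a j))
  | add {S S' : ∀ n : ℕ, (Fin n → Option A) → Fin n → Fin n → ℝ} : BoolBilin σ S →
      BoolBilin σ S' → BoolBilin σ fun n a i j => S n a i j + S' n a i j

namespace BoolBilin

variable {S S' : ∀ n : ℕ, (Fin n → Option A) → Fin n → Fin n → ℝ}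

lemma congr (hS : BoolBilin σ S) (h : ∀ n a i j, S' n a i j = S n a i j) : BoolBilin σ S' := by
  have : S' = S := by
    funext n a i j
    exact h n a i j
  exact this ▸ hS

lemma bilin (hS : BoolBilin σ S) : Bilin σ S := by
  induction hS with
  | mul r hb hc => exact (Bilin.mul hb hc).smul r
  | add _ _ ih ih' => exact ih.add ih'

lemma const (r : ℝ) : BoolBilin σ fun _ _ _ _ => r :=
  (mul r (.const true) (.const true)).congr fun _ _ _ _ => by simp [ofBool]

lemma left (hb : CompBool σ b) : BoolBilin σ fun n a i _ => ofBool (b n a i) :=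
  (mul 1 hb (.const true)).congr fun _ _ _ _ => by simp [ofBool]

lemma right (hb : CompBool σ b) : BoolBilin σ fun n a _ j => ofBool (b n a j) :=
  (mul 1 (.const true) hb).congr fun _ _ _ _ => by simp [ofBool]

/-- A Boolean function of one of the two positions. -/
lemma position (s : Bool) (hb : CompBool σ b) :
    BoolBilin σ fun n a i j => ofBool (b n a (bif s then i else j)) := by
  cases s
  exacts [right hb, left hb]

/-- Boolean factors, unlike general computable functions, can be multiplied at a position: their
product is their conjunction. -/
lemma prod (hS : BoolBilin σ S) (hS' : BoolBilin σ S') :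
    BoolBilin σ fun n a i j => S n a i j * S' n a i j := by
  induction hS with
  | add _ _ ih ih' => exact (ih.add ih').congr fun _ _ _ _ => add_mul _ _ _
  | @mul r b c hb hc =>
    induction hS' with
    | add _ _ ih ih' => exact (ih.add ih').congr fun _ _ _ _ => mul_add _ _ _
    | @mul r' b' c' hb' hc' =>
      refine (mul (r * r') (hb.and hb') (hc.and hc')).congr fun n a i j => ?_
      simp only [ofBool_and]
      ring

lemma sub (hS : BoolBilin σ S) (hS' : BoolBilin σ S') :
    BoolBilin σ fun n a i j => S n a i j - S' n a i j :=
  (hS.add ((const (-1)).prod hS')).congr fun _ _ _ _ => by ring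

lemma sum {ι : Type*} (s : Finset ι)
    {S : ι → ∀ n : ℕ, (Fin n → Option A) → Fin n → Fin n → ℝ} (hS : ∀ t, BoolBilin σ (S t)) :
    BoolBilin σ fun n a i j => ∑ t ∈ s, S t n a i j := by
  classical
  induction s using Finset.induction_on with
  | empty => simpa using const 0
  | insert t s ht ih => simpa [Finset.sum_insert ht] using (hS t).add ih

lemma cond {c : ∀ n : ℕ, (Fin n → Option A) → Fin n → Fin n → Bool}
    (hc : BoolBilin σ fun n a i j => ofBool (c n a i j)) (hS : BoolBilin σ S)
    (hS' : BoolBilin σ S') :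
    BoolBilin σ fun n a i j => bif c n a i j then S n a i j else S' n a i j :=
  ((hc.prod hS).add (((const 1).sub hc).prod hS')).congr fun n a i j => by
    cases c n a i j <;> simp [ofBool]

lemma attendable {F : ∀ n : ℕ, (Fin n → Option A) → Fin n → Fin n → Bool}
    (hF : BoolBilin σ fun n a i j => ofBool (F n a i j)) :
    Attendable σ fun n a i j => F n a i j = true := by
  refine ⟨_, _, (hF.sub (const 1)).bilin, Comp.const 1, fun n a i j => ?_⟩
  simp only
  cases F n a i j <;> simp [ofBool]

end BoolBilin

/-- The score is -(1/(x+2) - 1/(y+2))², expanded into bilinear terms. The squares come from looking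
up the position encoding at positions x and y, since x cannot be squared directly. -/
lemma Attendable.natEq (hx : Comp σ fun n a i => (x n a i : ℝ) / n)
    (hx' : ∀ n a i, x n a i < n) (hy : Comp σ fun n a i => (y n a i : ℝ) / n)
    (hy' : ∀ n a i, y n a i < n) : Attendable σ fun n a i j => x n a i = y n a j := by
  have hx₁ := Comp.lookup (x := fun n a i => ⟨x n a i, hx' n a i⟩) hx Comp.inv_pos
  have hx₂ := Comp.lookup (x := fun n a i => ⟨x n a i, hx' n a i⟩) hx Comp.inv_pos_sq
  have hy₁ := Comp.lookup (x := fun n a i => ⟨y n a i, hy' n a i⟩) hy Comp.inv_pos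
  have hy₂ := Comp.lookup (x := fun n a i => ⟨y n a i, hy' n a i⟩) hy Comp.inv_pos_sq
  refine ⟨_, _, ((Bilin.mul hx₁ hy₁).smul 2).sub ((Bilin.left hx₂).add (Bilin.right hy₂)),
    Comp.inv_length_pow 4, fun n a i j => ⟨by positivity, fun h => ?_, fun h => ?_⟩⟩
  · simp only at h
    simp only [h]
    field_simp
    ring
  · simp only at h ⊢
    have h1 := hx' n a i
    have h2 := hy' n a j
    generalize x n a i = X at *
    generalize y n a j = Y at *
    have hX : (X : ℝ) + 2 ≤ n + 1 := by exact_mod_cast (by omega : X + 2 ≤ n + 1)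
    have hY : (Y : ℝ) + 2 ≤ n + 1 := by exact_mod_cast (by omega : Y + 2 ≤ n + 1)
    have hX0 : (0 : ℝ) < (X : ℝ) + 2 := by positivity
    have hY0 : (0 : ℝ) < (Y : ℝ) + 2 := by positivity
    have hd : (1 : ℝ) ≤ ((X : ℝ) - Y) ^ 2 := by
      have : (0 : ℤ) < ((X : ℤ) - Y) ^ 2 := by
        have : (X : ℤ) - Y ≠ 0 := by omega
        positivity
      exact_mod_cast this
    have hXY : (((X : ℝ) + 2) * (Y + 2)) ^ 2 ≤ (n + 1) ^ 4 :=
      calc _ ≤ (((n : ℝ) + 1) * (n + 1)) ^ 2 := by gcongr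
        _ = _ := by ring
    -- Distinct integers differ by at least 1, and X + 2 and Y + 2 are at most n + 1; hence the
    -- margin.
    have key : 1 / ((n : ℝ) + 1) ^ 4 ≤ ((X : ℝ) - Y) ^ 2 / (((X : ℝ) + 2) * (Y + 2)) ^ 2 :=
      div_le_div₀ (by positivity) hd (by positivity) hXY
    have e : 2 * (1 / ((X : ℝ) + 2) * (1 / ((Y : ℝ) + 2))) -
        (1 / ((X : ℝ) + 2) ^ 2 + 1 / ((Y : ℝ) + 2) ^ 2) =
        -(((X : ℝ) - Y) ^ 2 / (((X : ℝ) + 2) * (Y + 2)) ^ 2) := by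
      field_simp
      ring
    rw [e]
    linarith

end

/-! ## Simulation of S-RASP -/

open SRASP

section

variable {A : Type*} {k : ℕ} {σ : Option A ≃ Fin k} {Δ : Type} [DecidableEq Δ]

/-- The vector is computed by an encoder: truth values and the one-hot encodings of symbols are
encoded by `0` and `1`, an integer `x` by `x / n`. -/
def Rep (σ : Option A ≃ Fin k) : (τ : Ty) → StringFun A (τ.Val Δ) → Prop
  | .bool, g => CompBool σ g
  | .char, g => ∀ δ : Δ, CompBool σ fun n a i => decide (@Eq Δ (g n a i) δ)
  | .nat, g => (Comp σ fun n a i => ((g n a i : ℕ) : ℝ) / n) ∧ ∀ n a i, @LT.lt ℕ _ (g n a i) n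

lemma ofBool_mem (b : Bool) : 0 ≤ ofBool b ∧ ofBool b ≤ 1 := by cases b <;> simp [ofBool]

lemma div_mem {n x : ℕ} (h : x < n) : 0 ≤ (x : ℝ) / n ∧ (x : ℝ) / n ≤ 1 :=
  ⟨by positivity, div_le_one_of_le₀ (by exact_mod_cast h.le) (Nat.cast_nonneg _)⟩

lemma Rep.cond {τ : Ty} {g h : StringFun A (τ.Val Δ)} {c : StringFun A Bool}
    (hc : CompBool σ c) (hg : Rep σ τ g) (hh : Rep σ τ h) :
    Rep σ τ fun n a i => bif c n a i then g n a i else h n a i := by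
  cases τ with
  | bool =>
    refine (Comp.cond hc hg hh (fun _ _ _ => ofBool_mem _) fun _ _ _ => ofBool_mem _).congr
      fun n a i => ?_
    exact Bool.apply_cond ofBool
  | char =>
    intro δ
    refine (Comp.cond hc (hg δ) (hh δ) (fun _ _ _ => ofBool_mem _) fun _ _ _ =>
      ofBool_mem _).congr fun n a i => ?_
    exact Bool.apply_cond fun t => ofBool (decide (@Eq Δ t δ))
  | nat =>
    refine ⟨(Comp.cond hc hg.1 hh.1 (fun n a i => div_mem (hg.2 n a i)) fun n a i =>
      div_mem (hh.2 n a i)).congr fun n a i => ?_, fun n a i => ?_⟩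
    · exact Bool.apply_cond fun t : ℕ => (t : ℝ) / n
    · simp only
      cases c n a i
      exacts [hh.2 n a i, hg.2 n a i]

lemma Rep.attn {τ : Ty} {g v d : StringFun A (τ.Val Δ)}
    {P : ∀ n : ℕ, (Fin n → Option A) → Fin n → Fin n → Prop} (hP : Attendable σ P)
    (c : Choice) (M : SRASP.Mask) (hv : Rep σ τ v) (hd : Rep σ τ d)
    (h : ∀ n a i, (∃ j, IsChoice c {j | M.test i j = true ∧ P n a i j} j ∧ g n a i = v n a j) ∨
      ((∀ j : Fin n, M.test i j = true → ¬ P n a i j) ∧ g n a i = d n a i)) :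
    Rep σ τ g := by
  cases τ with
  | bool =>
    refine hP.comp_attn_default c M hv hd (fun _ _ _ => ofBool_mem _) fun n a i => ?_
    exact (h n a i).imp (fun ⟨j, hj, hg⟩ => ⟨j, hj, by rw [hg]⟩) fun ⟨hn, hg⟩ => ⟨hn, by rw [hg]⟩
  | char =>
    intro δ
    refine hP.comp_attn_default c M (hv δ) (hd δ) (fun _ _ _ => ofBool_mem _) fun n a i => ?_
    exact (h n a i).imp (fun ⟨j, hj, hg⟩ => ⟨j, hj, by simp only [hg]⟩)
      fun ⟨hn, hg⟩ => ⟨hn, by simp only [hg]⟩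
  | nat =>
    refine ⟨hP.comp_attn_default c M hv.1 hd.1 (fun n a i => div_mem (hd.2 n a i))
      fun n a i => ?_, fun n a i => ?_⟩
    · exact (h n a i).imp (fun ⟨j, hj, hg⟩ => ⟨j, hj, by rw [hg]⟩)
        fun ⟨hn, hg⟩ => ⟨hn, by rw [hg]⟩
    · rcases h n a i with ⟨j, -, hg⟩ | ⟨-, hg⟩
      · rw [hg]; exact hv.2 n a j
      · rw [hg]; exact hd.2 n a i

/-- All the vectors of the environment are computed by encoders. -/
def RepEnv (σ : Option A ≃ Fin k) {Θ : List Ty} (ρ : ∀ n, (Fin n → Option A) → Env Δ n Θ) :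
    Prop :=
  ∀ τ (N : Name Θ τ), Rep σ τ fun n a => ρ n a τ N

lemma RepEnv.cons {Θ : List Ty} {ρ : ∀ n, (Fin n → Option A) → Env Δ n Θ} (hρ : RepEnv σ ρ)
    {τ : Ty} {g : StringFun A (τ.Val Δ)} (hg : Rep σ τ g) :
    RepEnv σ fun n a => (ρ n a).cons (g n a) := by
  intro τ' N
  cases N with
  | here => exact hg
  | there N => exact hρ τ' N

lemma ofBool_decide_eq_sum [Fintype Δ] (x y : Δ) :
    ofBool (decide (x = y)) = ∑ δ, ofBool (decide (x = δ)) * ofBool (decide (y = δ)) := by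
  simp [ofBool_decide]

variable {Θ : List Ty} {ρ : ∀ n, (Fin n → Option A) → Env Δ n Θ}

/-- Assigning the same position to all m variables lets one induction cover the one-variable
operands of `cmp` too. -/
lemma RepEnv.expr [Fintype Δ] (hρ : RepEnv σ ρ) {m : ℕ} {τ : Ty} (e : Expr Δ Θ m τ) :
    Rep σ τ fun n a i => e.eval (ρ n a) fun _ => i := by
  induction e with
  | vec P x => exact hρ _ P
  | ite a c b iha ihc ihb => exact Rep.cond ihc iha ihb
  | top => exact CompBool.const true
  | bot => exact CompBool.const false
  | and a b iha ihb => exact CompBool.and iha ihb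
  | or a b iha ihb => exact CompBool.or iha ihb
  | not a iha => exact CompBool.not iha
  | charEq a b iha ihb =>
    refine (Comp.sum Finset.univ fun δ => (iha δ).and (ihb δ)).congr fun n a' i => ?_
    exact (ofBool_decide_eq_sum (Δ := Δ) _ _).trans
      (Finset.sum_congr rfl fun δ _ => (ofBool_and _ _).symm)
  | cmp x op a b iha ihb => exact CompBool.cmp op iha.1 ihb.1
  | sym δ => exact fun δ' => CompBool.const (decide (δ = δ'))
  | zero =>
    refine ⟨(Comp.const 0).congr fun n a i => ?_, fun n a i => i.pos⟩
    change ((0 : ℕ) : ℝ) / n = 0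
    simp
  | one =>
    -- Clipping at n - 1 is, after division by n, a minimum with 1 - 1/n.
    refine ⟨(Comp.inv_length.min ((Comp.const 1).sub Comp.inv_length)).congr fun n a i => ?_,
      fun n a i => ?_⟩
    · change ((clip n 1 : ℕ) : ℝ) / n = _
      have hn : (0 : ℝ) < n := by exact_mod_cast i.pos
      rw [clip, Nat.cast_min, Nat.cast_sub i.pos, ← min_div_div_right hn.le, sub_div,
        div_self hn.ne']
      simp
    · exact lt_of_le_of_lt (Nat.min_le_right _ _) (Nat.sub_lt i.pos one_pos)
  | add a b iha ihb =>
    refine ⟨((iha.1.add ihb.1).min ((Comp.const 1).sub Comp.inv_length)).congr fun n a' i => ?_,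
      fun n a i => ?_⟩
    · change ((clip n (_ + _) : ℕ) : ℝ) / n = _
      have hn : (0 : ℝ) < n := by exact_mod_cast i.pos
      rw [clip, Nat.cast_min, Nat.cast_sub i.pos, ← min_div_div_right hn.le, sub_div,
        div_self hn.ne', Nat.cast_add, add_div]
      simp
    · exact lt_of_le_of_lt (Nat.min_le_right _ _) (Nat.sub_lt i.pos one_pos)
  | sub a b iha ihb =>
    refine ⟨(iha.1.sub ihb.1).relu.congr fun n a' i => ?_, fun n a i =>
      lt_of_le_of_lt (Nat.sub_le _ _) (iha.2 n a i)⟩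
    have hn : (0 : ℝ) < n := by exact_mod_cast i.pos
    have h : ∀ x y : ℕ, ((x - y : ℕ) : ℝ) / n = max 0 ((x : ℝ) / n - y / n) := by
      intro x y
      rcases le_total y x with hyx | hyx
      · rw [Nat.cast_sub hyx, max_eq_right, sub_div]
        rw [← sub_div]
        exact div_nonneg (sub_nonneg.2 (by exact_mod_cast hyx)) hn.le
      · rw [Nat.sub_eq_zero_of_le hyx, max_eq_left]
        · simp
        · rw [← sub_div]
          exact div_nonpos_of_nonpos_of_nonneg (sub_nonpos.2 (by exact_mod_cast hyx)) hn.le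
    exact h _ _

/-- The values of an expression at two positions are bilinear. -/
def BilinRep (σ : Option A ≃ Fin k) :
    (τ : Ty) → (∀ n, (Fin n → Option A) → Fin n → Fin n → τ.Val Δ) → Prop
  | .bool, F => BoolBilin σ fun n a i j => ofBool (F n a i j)
  | .char, F => ∀ δ : Δ, BoolBilin σ fun n a i j => ofBool (decide (@Eq Δ (F n a i j) δ))
  -- Integers affect a two-variable Boolean or symbol only through `cmp`, whose operands have a
  -- single variable.
  | .nat, _ => True

lemma RepEnv.expr₂ [Fintype Δ] (hρ : RepEnv σ ρ) {m : ℕ} {τ : Ty} (e : Expr Δ Θ m τ)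
    (s : Fin m → Bool) :
    BilinRep σ τ fun n a i j => e.eval (ρ n a) fun x => bif s x then i else j := by
  induction e with
  | @vec m τ P x =>
    have := hρ τ P
    cases τ with
    | bool => exact BoolBilin.position (s x) this
    | char => exact fun δ => BoolBilin.position (s x) (this δ)
    | nat => trivial
  | @ite m τ a c b iha ihc ihb =>
    cases τ with
    | bool =>
      refine (BoolBilin.cond (ihc s) (iha s) (ihb s)).congr fun n a' i j => ?_
      exact Bool.apply_cond ofBool
    | char =>
      intro δ
      refine (BoolBilin.cond (ihc s) (iha s δ) (ihb s δ)).congr fun n a' i j => ?_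
      exact Bool.apply_cond fun t => ofBool (decide (@Eq Δ t δ))
    | nat => trivial
  | top => exact BoolBilin.const _
  | bot => exact BoolBilin.const _
  | and a b iha ihb =>
    exact ((iha s).prod (ihb s)).congr fun _ _ _ _ =>
      ofBool_and _ _
  | or a b iha ihb =>
    exact (((iha s).add (ihb s)).sub ((iha s).prod (ihb s))).congr fun _ _ _ _ =>
      ofBool_or _ _
  | not a iha => exact ((BoolBilin.const 1).sub (iha s)).congr fun _ _ _ _ => ofBool_not _
  | charEq a b iha ihb =>
    exact (BoolBilin.sum Finset.univ fun δ => (iha s δ).prod (ihb s δ)).congr fun n a' i j =>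
      ofBool_decide_eq_sum (Δ := Δ) _ _
  | cmp x op a b => exact BoolBilin.position (s x) (CompBool.cmp op (hρ.expr a).1 (hρ.expr b).1)
  | sym δ => exact fun δ' => BoolBilin.const (ofBool (decide (δ = δ')))
  | zero => trivial
  | one => trivial
  | add => trivial
  | sub => trivial

lemma RepEnv.attnPred [Fintype Δ] (hρ : RepEnv σ ρ) (S : AttnPred Δ Θ) :
    Attendable σ fun n a i j => S.test (ρ n a) i j = true := by
  cases S with
  | expr e =>
    refine BoolBilin.attendable ?_
    refine BoolBilin.congr (hρ.expr₂ e ![true, false]) fun n a i j => ?_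
    have : (![i, j] : Fin 2 → Fin n) =
        fun x => bif (![true, false] : Fin 2 → Bool) x then i else j := by
      funext x
      fin_cases x <;> rfl
    simp only [AttnPred.test, this]
  | natEq V₁ V₂ =>
    have h₁ := hρ .nat V₁
    have h₂ := hρ .nat V₂
    simpa only [AttnPred.test, decide_eq_true_eq] using Attendable.natEq h₁.1 h₁.2 h₂.1 h₂.2

lemma RepEnv.op [Fintype Δ] (hρ : RepEnv σ ρ) {τ : Ty} (op : Op Δ Θ τ) :
    Rep σ τ fun n a => op.eval (ρ n a) := by
  cases op with
  | pointwise e => exact hρ.expr e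
  | attn c M S V D =>
    refine Rep.attn (hρ.attnPred S) c M (hρ.expr V) (hρ.expr D) fun n a i => ?_
    simp only [Op.eval]
    by_cases h : (Finset.univ.filter
        (fun j => M.test i j = true ∧ S.test (ρ n a) i j = true)).Nonempty
    · left
      rw [dif_pos h]
      cases c with
      | leftmost =>
        refine ⟨_, ⟨?_, fun j hj => ?_⟩, rfl⟩
        · simpa using Finset.min'_mem _ h
        · exact Finset.min'_le _ _ (by simpa using hj)
      | rightmost =>
        refine ⟨_, ⟨?_, fun j hj => ?_⟩, rfl⟩
        · simpa using Finset.max'_mem _ h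
        · exact Finset.le_max' _ _ (by simpa using hj)
    · right
      rw [dif_neg h]
      refine ⟨fun j hj hj' => h ⟨j, by simp [hj, hj']⟩, rfl⟩
  | prefixSum V =>
    exact ⟨Comp.prefixSum (hρ.expr V).1, fun n a i =>
      lt_of_le_of_lt (Nat.min_le_right _ _) (Nat.sub_lt i.pos one_pos)⟩

end

/-! ### Whole programs -/

section

variable {A : Type*} {k : ℕ} {σ : Option A ≃ Fin k} {Δ : Type} [DecidableEq Δ]

lemma RepEnv.code [Fintype Δ] {Θ : List Ty} (c : Code Δ Θ)
    {ρ : ∀ n, (Fin n → Option A) → Env Δ n Θ} (hρ : RepEnv σ ρ) :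
    Rep σ .char fun n a => c.eval (ρ n a) := by
  induction c with
  | out P => exact hρ .char P
  | define op rest ih => exact ih (hρ.cons (hρ.op op))

lemma RepEnv.init (σ : Option A ≃ Fin k) (s : Option A → Δ) :
    RepEnv σ fun n (a : Fin n → Option A) => initEnv fun i => s (a i) := by
  refine RepEnv.cons (RepEnv.cons (ρ := fun _ _ => Env.nil) (fun τ N => nomatch N) ?_) ?_
  · exact ⟨Comp.pos, fun n a i => i.isLt⟩
  · intro δ
    refine (Comp.sum Finset.univ fun c => (Comp.input c).smul
      (ofBool (decide (s (σ.symm c) = δ)))).congr fun n a i => ?_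
    simp

end

end AHAT

theorem mainTheorem9 {A B : Type*} {k k' : ℕ} (σ : Option A ≃ Fin k) (γ : Option B ≃ Fin k')
    (P : SRASP.Program A B) (f : List A → List B) (q : ℕ → ℕ)
    (hP : ComputesWith P.Outputs f q) :
    ∃ T : AHAT.Encoder k k', ComputesWith (T.Outputs σ γ) f q := by
  let := P.decEqΔ
  let := P.fintypeΔ
  have h := (AHAT.RepEnv.init σ P.inSym).code P.code
  -- Coordinate c holds the indicator of the output symbol numbered c by γ; as a `Comp` function it
  -- is 0 at the default position, as required.
  obtain ⟨T, hT⟩ := AHAT.Computable.exists_encoder (k' := k')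
    fun c : Fin k' => h (P.outSym (γ.symm c))
  refine ⟨T, hP.1, fun w => ⟨(hP.2 w).1, fun n hn hq => ⟨fun i c => ?_, fun c => ?_⟩⟩⟩
  · have hout : P.code.eval (SRASP.initEnv fun i => P.inSym (padTo n w i)) =
      fun i => P.outSym (padTo n (f w) i) := (hP.2 w).2 n hn hq
    rw [hT, Fin.cases_succ]
    simp only [hout, AHAT.ofBool_decide]
    refine if_congr ?_ rfl rfl
    rw [P.outSym.injective.eq_iff, Equiv.eq_symm_apply]
  · rw [hT, Fin.cases_zero]
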